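/- All graphs are simple and may be infinite, also not locally finite. For a nonempty connected graph $G$, regard $G$ as a geodesic metric space in which every edge is isometric to $[0,1]$ and the distance of two points (vertices or points of edges) is the length of a shortest path between them. A geodesic triangle $T$ consists of three points and three geodesics joining them pairwise; $\delta(T)$ is the infimum of all $\delta\ge 0$ such that each of the three geodesics lies in the $\delta$-neighbourhood of the union of the two others, and $\delta(G)\in[0,\infty]$ is the supremum of $\delta(T)$ over all geodesic triangles $T$ in $G$. The circumference $c(G)\in\mathbb{N}\cup\{\infty\}$ is the supremum of the lengths of the cycles of $G$ (with $c(G)=0$ if there are none). For $e\in E(G)$, $G/e$ denotes the simple graph obtained by contracting $e$: the two endpoints of $e$ are merged, $e$ is removed, and parallel edges that arise are replaced by a single edge. **Theorem 2.15.** Let $G$ be a nonempty connected graph in which each edge belongs to at most one cycle. 1. If either $c(G)=\infty$, or $c(G)<\infty$ and at least two different cycles of $G$ have length $c(G)$, then $\delta(G/e)=\delta(G)$ for every $e\in E(G)$. 2. If $c(G)<\infty$ and exactly one cycle $C$ of $G$ has length $c(G)$, then for every $e\in E(G)$: $\delta(G/e)=\delta(G)$ if and only if $e\notin E(C)$. 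-/

import Mathlib

open scoped ENNReal NNReal

/-! ### Gromov hyperbolicity (Rips condition) -/

section Hyperbolic

variable {X : Type*} [EMetricSpace X]

/-- `S` is (the image of) a geodesic joining `x` and `y`, parametrized by arc length. -/
def IsGeodesicSegment (x y : X) (S : Set X) : Prop :=
  ∃ (L : ℝ) (γ : ℝ → X), 0 ≤ L ∧ γ 0 = x ∧ γ L = y ∧
    (∀ s ∈ Set.Icc 0 L, ∀ t ∈ Set.Icc 0 L, edist (γ s) (γ t) = ENNReal.ofReal |s - t|) ∧
    S = γ '' Set.Icc 0 L

/-- The sets `a`, `b`, `c` are the three sides of a geodesic triangle. The three corners are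
arbitrary, they may coincide. -/
def IsGeodesicTriangle (a b c : Set X) : Prop :=
  ∃ x y z : X, IsGeodesicSegment x y a ∧ IsGeodesicSegment y z b ∧ IsGeodesicSegment z x c

/-- Every side is contained in the `d`-neighbourhood of the union of the two other sides. -/
def IsThinTriangle (d : ℝ≥0) (a b c : Set X) : Prop :=
  (∀ p ∈ a, Metric.infEDist p (b ∪ c) ≤ d) ∧
  (∀ p ∈ b, Metric.infEDist p (c ∪ a) ≤ d) ∧
  (∀ p ∈ c, Metric.infEDist p (a ∪ b) ≤ d)

/-- The sharp thin constant `δ(T)` of a triangle with sides `a`, `b`, `c`. -/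
noncomputable def thinConstant (a b c : Set X) : ℝ≥0∞ :=
  ⨅ (d : ℝ≥0) (_ : IsThinTriangle d a b c), (d : ℝ≥0∞)

variable (X) in
/-- The sharp hyperbolicity constant `δ(X) ∈ [0, ∞]`: the supremum of `δ(T)` over all geodesic
triangles `T` of `X`. -/
noncomputable def hyperbolicityConstant : ℝ≥0∞ :=
  ⨆ (a : Set X) (b : Set X) (c : Set X) (_ : IsGeodesicTriangle a b c), thinConstant a b c

end Hyperbolic

namespace SimpleGraph

/-! ### A graph as a metric space -/

section MetricGraph

variable {V : Type*}

open Classical in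
/-- The vertex `v`, as a point of the realization of a graph in barycentric coordinates. -/
noncomputable def vertexCoord (v : V) : V → ℝ := Pi.single v 1

/-- In barycentric coordinates: `p` lies on the closed edge `[u, v]` of `G`, or is the
vertex `u = v`. The points of `[u, v]` are `(1 - t) u + t v` for `t ∈ [0, 1]`. -/
def OnEdge (G : SimpleGraph V) (u v : V) (p : V → ℝ) : Prop :=
  (u = v ∨ G.Adj u v) ∧ p ∈ segment ℝ (vertexCoord u) (vertexCoord v)

/-- The points of the graph `G` seen as a one-dimensional space: its vertices and the points of
its edges. -/
def MetricGraph (G : SimpleGraph V) : Type _ := {p : V → ℝ // ∃ u v, G.OnEdge u v p}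

open Classical in
/-- Length of the straight segment between `p` and `q` if they lie on a common closed edge, which
is isometric to `[0, 1]`; infinite otherwise. For `p = (1 - s) u + s v` and `q = (1 - t) u + t v`
the supremum of the coordinate distances is `|s - t|`. -/
noncomputable def edgeDist (G : SimpleGraph V) (p q : V → ℝ) : ℝ≥0∞ :=
  if ∃ u v, G.OnEdge u v p ∧ G.OnEdge u v q then ⨆ w, EDist.edist (p w) (q w) else ⊤

/-- Length of a shortest path from `p` to `q` in which all edges have length one: the path either
stays within one edge, or goes from `p` along an edge to a vertex `u`, then along edges to a
vertex `v`, and then along an edge to `q`. -/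
noncomputable def pathDist (G : SimpleGraph V) (p q : V → ℝ) : ℝ≥0∞ :=
  min (G.edgeDist p q)
    (⨅ (u : V) (v : V), G.edgeDist p (vertexCoord u) + ((G.edist u v : ℕ∞) : ℝ≥0∞) +
      G.edgeDist (vertexCoord v) q)

variable {G : SimpleGraph V}

lemma OnEdge.symm {u v : V} {p : V → ℝ} (h : G.OnEdge u v p) : G.OnEdge v u p :=
  ⟨h.1.imp Eq.symm Adj.symm, segment_symm ℝ (vertexCoord u) (vertexCoord v) ▸ h.2⟩

lemma vertexCoord_self (v : V) : vertexCoord v v = 1 := by simp [vertexCoord]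

lemma vertexCoord_of_ne {v w : V} (h : w ≠ v) : vertexCoord v w = 0 := by
  simp [vertexCoord, h]

lemma OnEdge.eq_or_eq {u v w : V} {p : V → ℝ} (h : G.OnEdge u v p) (hw : p w ≠ 0) :
    w = u ∨ w = v := by
  obtain ⟨-, a, b, -, -, -, rfl⟩ := h
  by_contra! hc
  simp [vertexCoord_of_ne hc.1, vertexCoord_of_ne hc.2] at hw

lemma OnEdge.left_ne_zero {u v : V} {p : V → ℝ} (h : G.OnEdge u v p)
    (hp : ∀ x, p ≠ vertexCoord x) : p u ≠ 0 := by
  obtain ⟨-, a, b, ha, hb, hab, rfl⟩ := h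
  intro h0
  by_cases huv : u = v
  · subst huv
    apply hp u
    rw [← add_smul, hab, one_smul]
  · have ha0 : a = 0 := by
      simpa [vertexCoord_self, vertexCoord_of_ne huv] using h0
    apply hp v
    have hb1 : b = 1 := by linarith
    simp [ha0, hb1]

lemma OnEdge.ne {u v : V} {p : V → ℝ} (h : G.OnEdge u v p)
    (hp : ∀ x, p ≠ vertexCoord x) : u ≠ v := by
  rintro rfl
  obtain ⟨-, h⟩ := h
  rw [segment_same] at h
  exact hp u h

lemma OnEdge.unique {u v u' v' : V} {p : V → ℝ} (h : G.OnEdge u v p) (h' : G.OnEdge u' v' p)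
    (hp : ∀ x, p ≠ vertexCoord x) : (u' = u ∧ v' = v) ∨ (u' = v ∧ v' = u) := by
  have h1 := h.eq_or_eq (h'.left_ne_zero hp)
  have h2 := h.eq_or_eq (h'.symm.left_ne_zero hp)
  have h3 := h'.ne hp
  grind

lemma onEdge_vertexCoord (v : V) : G.OnEdge v v (vertexCoord v) :=
  ⟨Or.inl rfl, left_mem_segment ..⟩

lemma edgeDist_self {p : V → ℝ} (hp : ∃ u v, G.OnEdge u v p) : G.edgeDist p p = 0 := by
  obtain ⟨u, v, h⟩ := hp
  rw [edgeDist, if_pos ⟨u, v, h, h⟩]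
  simp

lemma edgeDist_comm (p q : V → ℝ) : G.edgeDist p q = G.edgeDist q p := by
  classical
  unfold edgeDist
  exact if_congr ⟨fun ⟨u, v, h, h'⟩ => ⟨u, v, h', h⟩, fun ⟨u, v, h, h'⟩ => ⟨u, v, h', h⟩⟩
    (iSup_congr fun w => PseudoEMetricSpace.edist_comm _ _) rfl

lemma eq_of_edgeDist_eq_zero {p q : V → ℝ} (h : G.edgeDist p q = 0) : p = q := by
  unfold edgeDist at h
  split_ifs at h
  · funext w
    simpa using (iSup_eq_bot.1 h) w
  · simp at h

lemma edgeDist_triangle {p q r : V → ℝ} (hr : ∀ x, r ≠ vertexCoord x) :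
    G.edgeDist p q ≤ G.edgeDist p r + G.edgeDist r q := by
  by_cases h1 : ∃ u v, G.OnEdge u v p ∧ G.OnEdge u v r
  · by_cases h2 : ∃ u v, G.OnEdge u v r ∧ G.OnEdge u v q
    · have h3 : ∃ u v, G.OnEdge u v p ∧ G.OnEdge u v q := by
        obtain ⟨u, v, hp, hr1⟩ := h1
        obtain ⟨u', v', hr2, hq⟩ := h2
        rcases hr1.unique hr2 hr with ⟨rfl, rfl⟩ | ⟨rfl, rfl⟩
        · exact ⟨_, _, hp, hq⟩
        · exact ⟨_, _, hp.symm, hq⟩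
      rw [edgeDist, edgeDist, edgeDist, if_pos h1, if_pos h2, if_pos h3]
      refine iSup_le fun w => (PseudoEMetricSpace.edist_triangle _ (r w) _).trans ?_
      exact add_le_add (le_iSup (fun w => EDist.edist (p w) (r w)) w)
        (le_iSup (fun w => EDist.edist (r w) (q w)) w)
    · simp [edgeDist, if_neg h2]
  · simp [edgeDist, if_neg h1]

lemma edist_le_edgeDist (u v : V) :
    ((G.edist u v : ℕ∞) : ℝ≥0∞) ≤ G.edgeDist (vertexCoord u) (vertexCoord v) := by
  by_cases huv : u = v
  · subst huv; simp
  unfold edgeDist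
  split_ifs with h
  · obtain ⟨a, b, hu, hv⟩ := h
    have h1 := hu.eq_or_eq (w := u) (by simp [vertexCoord_self])
    have h2 := hv.eq_or_eq (w := v) (by simp [vertexCoord_self])
    have hadj : G.Adj u v := by
      have := hu.1
      have h3 : G.Adj a b → G.Adj b a := fun h => h.symm
      grind
    have h3 : G.edist u v ≤ 1 := by simpa using G.edist_le hadj.toWalk
    calc ((G.edist u v : ℕ∞) : ℝ≥0∞) ≤ ((1 : ℕ∞) : ℝ≥0∞) := by exact_mod_cast h3
      _ = EDist.edist (vertexCoord u u) (vertexCoord v u) := by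
        simp [vertexCoord_self, vertexCoord_of_ne huv, edist_dist]
      _ ≤ _ := le_iSup (fun w => EDist.edist (vertexCoord u w) (vertexCoord v w)) u
  · exact le_top

lemma coe_edist_triangle (u v w : V) : ((G.edist u w : ℕ∞) : ℝ≥0∞) ≤
    ((G.edist u v : ℕ∞) : ℝ≥0∞) + ((G.edist v w : ℕ∞) : ℝ≥0∞) := by
  exact_mod_cast G.edist_triangle

lemma edist_le_edgeDist_add (r : V → ℝ) (u v : V) : ((G.edist u v : ℕ∞) : ℝ≥0∞) ≤
    G.edgeDist (vertexCoord u) r + G.edgeDist r (vertexCoord v) := by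
  by_cases hr : ∃ x, r = vertexCoord x
  · obtain ⟨x, rfl⟩ := hr
    exact (coe_edist_triangle u x v).trans
      (add_le_add (edist_le_edgeDist u x) (edist_le_edgeDist x v))
  · exact (edist_le_edgeDist u v).trans (edgeDist_triangle (by simpa using hr))

lemma exists_edgeDist_add_le (p r : V → ℝ) (u v : V) :
    ∃ u', G.edgeDist p (vertexCoord u') + ((G.edist u' v : ℕ∞) : ℝ≥0∞) ≤
      G.edgeDist p r + (G.edgeDist r (vertexCoord u) + ((G.edist u v : ℕ∞) : ℝ≥0∞)) := by
  by_cases hr : ∃ x, r = vertexCoord x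
  · obtain ⟨x, rfl⟩ := hr
    exact ⟨x, add_le_add le_rfl ((coe_edist_triangle x u v).trans
      (add_le_add (edist_le_edgeDist x u) le_rfl))⟩
  · refine ⟨u, ?_⟩
    rw [← add_assoc]
    exact add_le_add (edgeDist_triangle (by simpa using hr)) le_rfl

lemma pathDist_le (p q : V → ℝ) (u v : V) : G.pathDist p q ≤
    G.edgeDist p (vertexCoord u) + ((G.edist u v : ℕ∞) : ℝ≥0∞) +
      G.edgeDist (vertexCoord v) q :=
  (min_le_right _ _).trans ((iInf_le _ u).trans (iInf_le _ v))

lemma pathDist_comm (p q : V → ℝ) : G.pathDist p q = G.pathDist q p := by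
  unfold pathDist
  rw [edgeDist_comm, iInf_comm]
  congr 1
  refine iInf_congr fun v => iInf_congr fun u => ?_
  rw [G.edist_comm, edgeDist_comm p, edgeDist_comm _ q]
  ring

lemma pathDist_triangle (p q r : V → ℝ) :
    G.pathDist p q ≤ G.pathDist p r + G.pathDist r q := by
  have key : ∀ p q r : V → ℝ, ∀ u v, G.pathDist p q ≤ G.edgeDist p r +
      (G.edgeDist r (vertexCoord u) + ((G.edist u v : ℕ∞) : ℝ≥0∞) +
        G.edgeDist (vertexCoord v) q) := by
    intro p q r u v
    obtain ⟨u', h⟩ := G.exists_edgeDist_add_le p r u v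
    refine (pathDist_le p q u' v).trans ?_
    rw [← add_assoc]
    exact add_le_add h le_rfl
  have lower : ∀ (a c : ℝ≥0∞) (p q : V → ℝ), a ≤ c + G.edgeDist p q →
      (∀ u v, a ≤ c + (G.edgeDist p (vertexCoord u) + ((G.edist u v : ℕ∞) : ℝ≥0∞) +
        G.edgeDist (vertexCoord v) q)) → a ≤ c + G.pathDist p q := by
    intro a c p q h1 h2
    unfold pathDist
    rw [min_def]
    split_ifs
    · exact h1
    · rw [ENNReal.add_iInf]
      refine le_iInf fun u => ?_
      rw [ENNReal.add_iInf]
      exact le_iInf fun v => h2 u v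
  apply lower
  · rw [add_comm]
    apply lower
    · by_cases hr : ∃ x, r = vertexCoord x
      · obtain ⟨x, rfl⟩ := hr
        refine (pathDist_le p q x x).trans ?_
        simp [add_comm]
      · rw [add_comm]
        exact (min_le_left _ _).trans (edgeDist_triangle (by simpa using hr))
    · intro u v
      rw [pathDist_comm p q]
      have := key q p r v u
      rw [edgeDist_comm q r, G.edist_comm, edgeDist_comm _ p,
        edgeDist_comm r (vertexCoord v)] at this
      refine this.trans (le_of_eq ?_)
      ring
  · intro u v
    rw [add_comm]
    apply lower
    · rw [add_comm]
      exact key p q r u v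
    · intro u' v'
      refine (pathDist_le p q u' v).trans ?_
      have h := edist_le_edgeDist_add (G := G) r v' u
      have h' := (coe_edist_triangle (G := G) u' v' v).trans
        (add_le_add le_rfl (coe_edist_triangle v' u v))
      calc _ ≤ G.edgeDist p (vertexCoord u') + (((G.edist u' v' : ℕ∞) : ℝ≥0∞) +
            ((G.edgeDist (vertexCoord v') r + G.edgeDist r (vertexCoord u)) +
              ((G.edist u v : ℕ∞) : ℝ≥0∞))) + G.edgeDist (vertexCoord v) q := by
            gcongr
            exact h'.trans (by gcongr)
        _ = _ := by ring

lemma coord_le_edgeDist (p q : V → ℝ) (w : V) : EDist.edist (p w) (q w) ≤ G.edgeDist p q := by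
  unfold edgeDist
  split_ifs
  · exact le_iSup (fun w => EDist.edist (p w) (q w)) w
  · exact le_top

lemma eq_of_pathDist_eq_zero {p q : V → ℝ} (h : G.pathDist p q = 0) : p = q := by
  by_contra hne
  obtain ⟨w, hw⟩ := Function.ne_iff.1 hne
  have hpos : 0 < EDist.edist (p w) (q w) := edist_pos.2 hw
  have hlow : min 1 (EDist.edist (p w) (q w)) ≤ G.pathDist p q := by
    refine le_min ((min_le_right _ _).trans (coord_le_edgeDist p q w))
      (le_iInf fun u => le_iInf fun v => ?_)
    by_cases huv : u = v
    · subst huv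
      refine (min_le_right _ _).trans ((PseudoEMetricSpace.edist_triangle _ (vertexCoord u w) _).trans ?_)
      exact add_le_add ((coord_le_edgeDist p _ w).trans le_self_add) (coord_le_edgeDist _ q w)
    · have h1 : 1 ≤ G.edist u v := Order.one_le_iff_ne_zero.2 (by simpa using huv)
      have h2 : (1 : ℝ≥0∞) ≤ ((G.edist u v : ℕ∞) : ℝ≥0∞) := by exact_mod_cast h1
      exact (min_le_left _ _).trans (h2.trans (le_add_self.trans le_self_add))
  rw [h] at hlow
  exact absurd hlow (not_le.2 (lt_min one_pos hpos))

noncomputable instance (G : SimpleGraph V) : EMetricSpace G.MetricGraph where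
  edist p q := G.pathDist p.1 q.1
  edist_self p := le_antisymm ((min_le_left _ _).trans (edgeDist_self p.2).le) bot_le
  edist_comm p q := pathDist_comm p.1 q.1
  edist_triangle p q r := pathDist_triangle p.1 r.1 q.1
  eq_of_edist_eq_zero h := Subtype.ext (eq_of_pathDist_eq_zero h)

end MetricGraph

/-! ### Cycles and contraction -/

variable {V : Type*}

/-- `C` is a cycle of `G`: the subgraph traced by a closed walk without repeated edges whose
vertices are distinct, except that the last one is the first one. -/
def IsCycleSubgraph (G : SimpleGraph V) (C : G.Subgraph) : Prop :=
  ∃ (u : V) (w : G.Walk u u), w.IsCycle ∧ w.toSubgraph = C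

/-- Each edge of `G` belongs to at most one cycle. -/
def HasProperCycles (G : SimpleGraph V) : Prop :=
  ∀ e ∈ G.edgeSet, ∀ C D : G.Subgraph, G.IsCycleSubgraph C → G.IsCycleSubgraph D →
    e ∈ C.edgeSet → e ∈ D.edgeSet → C = D

/-- The circumference of `G`: the supremum in `ℕ ∪ {∞}` of the lengths of its cycles
(`0` if there is none). -/
noncomputable def circumference (G : SimpleGraph V) : ℕ∞ :=
  ⨆ (C : G.Subgraph) (_ : G.IsCycleSubgraph C), C.edgeSet.encard

/-- The set of cycles whose length is the circumference. -/
def longestCycles (G : SimpleGraph V) : Set G.Subgraph :=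
  {C | G.IsCycleSubgraph C ∧ C.edgeSet.encard = G.circumference}

/-- Identify the two endpoints of `e` with each other, and no other vertices. -/
def contractSetoid (e : Sym2 V) : Setoid V where
  r u v := u = v ∨ (u ∈ e ∧ v ∈ e)
  iseqv := ⟨fun _ => Or.inl rfl, by grind, by grind⟩

/-- The simple graph `G / e`: the endpoints of `e` are merged, the loop that arises from `e` is
removed, and parallel edges are replaced by a single edge. -/
def contract (G : SimpleGraph V) (e : Sym2 V) : SimpleGraph (Quotient (contractSetoid e)) :=
  G.map (Quotient.mk (contractSetoid e))

end SimpleGraph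

/-! The proof rests on `δ = c / 4`, established as two separate bounds that use only certificates
which pass to `G / e`. The cycles of `G / e` are therefore never classified.

An edge on no cycle is a bridge, certified by a `0`-`1` function on the vertices that changes only
across that edge (`IsSplit`). A cycle `C` is certified by a retraction of the vertices onto it
(`GatedCycle`). If no edge lies on two cycles, different vertices of `C` are in different components
once the edges of `C` are deleted, and by connectedness every component meets `C`. So each vertex
has a unique gate on `C` (`HasProperCycles.exists_gatedCycle`).

Lower bound: the gates extend to a `1`-Lipschitz map onto the circle of length `n`, so the cycle is
isometrically embedded. Two antipodal points cut it into two geodesics, and the midpoint of one has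
distance `n / 4` from the other (`GatedCycle.le_hyperbolicityConstant`).

Upper bound: compare a geodesic with any connected set `S` through its ends, such as the union of
the two other sides of a triangle. `S` contains each interior point of a bridge on the geodesic. At
a nonvertex point of a gated `n`-cycle, the geodesic meets `S` on that cycle both before and after
the point. These meeting points are at most `n / 2` apart, so one is within `n / 4` of the given
point (`hyperbolicityConstant_le_of_isSplit_or`).

Contraction of `e` preserves the certificates of other bridges and of cycles avoiding `e`. It
shortens a gated cycle through `e` by one, or turns a triangle into a bridge. So `δ` is unchanged if
a longest cycle avoids `e`, and drops to at most `(c - 1) / 4` if the only longest cycle contains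
`e`. If `c = ∞`, the cycles avoiding `e` are still unbounded, since `e` lies on at most one cycle.
-/

namespace SimpleGraph

/-! ### Points of the metric graph and Lipschitz extension of vertex functions. -/

section MetricGraphBasics

variable {V : Type*} {G : SimpleGraph V}

/-- The point `(1 - t) u + t v` in barycentric coordinates. -/
noncomputable def lineCoord (u v : V) (t : ℝ) : V → ℝ :=
  (1 - t) • vertexCoord u + t • vertexCoord v

lemma lineCoord_zero (u v : V) : lineCoord u v 0 = vertexCoord u := by simp [lineCoord]

lemma lineCoord_one (u v : V) : lineCoord u v 1 = vertexCoord v := by simp [lineCoord]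

lemma lineCoord_self (u : V) (t : ℝ) : lineCoord u u t = vertexCoord u := by
  simp [lineCoord, ← add_smul]

lemma lineCoord_symm (u v : V) (t : ℝ) : lineCoord u v t = lineCoord v u (1 - t) := by
  simp [lineCoord, add_comm]

lemma lineCoord_left {u v : V} (h : u ≠ v) (t : ℝ) : lineCoord u v t u = 1 - t := by
  simp [lineCoord, vertexCoord_self, vertexCoord_of_ne h]

lemma lineCoord_right {u v : V} (h : u ≠ v) (t : ℝ) : lineCoord u v t v = t := by
  simp [lineCoord, vertexCoord_self, vertexCoord_of_ne h.symm]

lemma vertexCoord_injective : Function.Injective (vertexCoord : V → V → ℝ) := by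
  intro u v h
  by_contra hne
  have := congrFun h u
  simp [vertexCoord_self, vertexCoord_of_ne hne] at this

lemma onEdge_iff {u v : V} {p : V → ℝ} : G.OnEdge u v p ↔
    (u = v ∨ G.Adj u v) ∧ ∃ t ∈ Set.Icc (0 : ℝ) 1, p = lineCoord u v t := by
  unfold OnEdge
  rw [segment_eq_image]
  simp [lineCoord, eq_comm]

lemma onEdge_lineCoord {u v : V} (h : u = v ∨ G.Adj u v) {t : ℝ} (ht : t ∈ Set.Icc (0 : ℝ) 1) :
    G.OnEdge u v (lineCoord u v t) := onEdge_iff.2 ⟨h, t, ht, rfl⟩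

/-- The point `(1 - t) u + t v` of the metric graph. -/
noncomputable def edgePoint {u v : V} (h : G.Adj u v) (t : ℝ) (ht : t ∈ Set.Icc (0 : ℝ) 1) :
    G.MetricGraph := ⟨lineCoord u v t, u, v, onEdge_lineCoord (Or.inr h) ht⟩

/-- The vertex `v` as a point of the metric graph. -/
noncomputable def vertexPoint (G : SimpleGraph V) (v : V) : G.MetricGraph :=
  ⟨vertexCoord v, v, v, onEdge_vertexCoord v⟩

lemma edgePoint_zero {u v : V} (h : G.Adj u v) (h0 : (0 : ℝ) ∈ Set.Icc (0 : ℝ) 1) :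
    edgePoint h 0 h0 = G.vertexPoint u := Subtype.ext (lineCoord_zero u v)

lemma edgePoint_one {u v : V} (h : G.Adj u v) (h1 : (1 : ℝ) ∈ Set.Icc (0 : ℝ) 1) :
    edgePoint h 1 h1 = G.vertexPoint v := Subtype.ext (lineCoord_one u v)

lemma edgePoint_symm {u v : V} (h : G.Adj u v) {t : ℝ} (ht : t ∈ Set.Icc (0 : ℝ) 1) :
    edgePoint h t ht = edgePoint h.symm (1 - t) (by simpa using ht.symm) :=
  Subtype.ext (lineCoord_symm u v t)

lemma eq_vertexPoint_or_edgePoint (q : G.MetricGraph) : (∃ v, q = G.vertexPoint v) ∨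
    ∃ u v, ∃ (h : G.Adj u v) (t : ℝ) (ht : t ∈ Set.Ioo (0 : ℝ) 1),
      q = edgePoint h t (Set.Ioo_subset_Icc_self ht) := by
  obtain ⟨q, u, v, hq⟩ := q
  obtain ⟨h, t, ht, rfl⟩ := onEdge_iff.1 hq
  rcases h with rfl | h
  · exact Or.inl ⟨u, Subtype.ext (lineCoord_self u t)⟩
  rcases eq_or_ne t 0 with rfl | h0
  · exact Or.inl ⟨u, Subtype.ext (lineCoord_zero u v)⟩
  rcases eq_or_ne t 1 with rfl | h1
  · exact Or.inl ⟨v, Subtype.ext (lineCoord_one u v)⟩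
  exact Or.inr ⟨u, v, h, t, ⟨lt_of_le_of_ne ht.1 h0.symm, lt_of_le_of_ne ht.2 h1⟩, rfl⟩

lemma edgeDist_lineCoord_le {u v : V} (h : G.Adj u v) {s t : ℝ} (hs : s ∈ Set.Icc (0 : ℝ) 1)
    (ht : t ∈ Set.Icc (0 : ℝ) 1) :
    G.edgeDist (lineCoord u v s) (lineCoord u v t) ≤ ENNReal.ofReal |s - t| := by
  unfold edgeDist
  rw [if_pos ⟨u, v, onEdge_lineCoord (Or.inr h) hs, onEdge_lineCoord (Or.inr h) ht⟩]
  refine iSup_le fun w => ?_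
  rw [edist_dist, Real.dist_eq]
  apply ENNReal.ofReal_le_ofReal
  by_cases hu : w = u
  · subst hu
    rw [lineCoord_left h.ne, lineCoord_left h.ne, abs_sub_comm]
    ring_nf
    rfl
  by_cases hv : w = v
  · subst hv
    rw [lineCoord_right h.ne, lineCoord_right h.ne]
  · simp [lineCoord, vertexCoord_of_ne hu, vertexCoord_of_ne hv]

lemma edist_edgePoint_le {u v : V} (h : G.Adj u v) {s t : ℝ} (hs : s ∈ Set.Icc (0 : ℝ) 1)
    (ht : t ∈ Set.Icc (0 : ℝ) 1) :
    EDist.edist (edgePoint h s hs) (edgePoint h t ht) ≤ ENNReal.ofReal |s - t| :=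
  (min_le_left _ _).trans (edgeDist_lineCoord_le h hs ht)

lemma edist_map_le_edist {Z : Type*} [PseudoEMetricSpace Z] {f : V → Z}
    (hf : ∀ u v, G.Adj u v → EDist.edist (f u) (f v) ≤ 1) (u v : V) :
    EDist.edist (f u) (f v) ≤ ((G.edist u v : ℕ∞) : ℝ≥0∞) := by
  have key : ∀ {u v : V} (w : G.Walk u v), EDist.edist (f u) (f v) ≤ (w.length : ℝ≥0∞) := by
    intro u v w
    induction w with
    | nil => simp
    | cons h p ih =>
      refine (PseudoEMetricSpace.edist_triangle _ _ _).trans ((add_le_add (hf _ _ h) ih).trans ?_)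
      simp [add_comm]
  by_cases h : G.Reachable u v
  · obtain ⟨w, hw⟩ := h.exists_walk_length_eq_edist
    rw [← hw]
    exact key w
  · rw [edist_eq_top_of_not_reachable h]
    simp

/-- A map on the vertices that moves adjacent vertices by at most `1` extends to a `1`-Lipschitz
map on the metric graph, the edge `[u, v]` going to the image of `[0, d u v]` under `κ`,
translated to `f u`. -/
theorem exists_lipschitz_extension {Z : Type*} [SeminormedAddCommGroup Z] (κ : ℝ →+ Z)
    (hκ : ∀ x, ‖κ x‖ ≤ |x|) (f : V → Z) (d : V → V → ℝ) (hanti : ∀ u v, d v u = -d u v)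
    (hd : ∀ u v, G.Adj u v → f v = f u + κ (d u v) ∧ |d u v| ≤ 1) :
    ∃ F : G.MetricGraph → Z, LipschitzWith 1 F ∧ (∀ v, F (G.vertexPoint v) = f v) ∧
      ∀ u v (h : G.Adj u v) (t : ℝ) (ht : t ∈ Set.Icc (0 : ℝ) 1),
        F (edgePoint h t ht) = f u + κ (t * d u v) := by
  have hself : ∀ u, d u u = 0 := fun u => by linarith [hanti u u]
  have hvert : ∀ u v x, G.OnEdge u v (vertexCoord x) →
      f u + κ (vertexCoord x v * d u v) = f x := by
    intro u v x h
    rcases h.eq_or_eq (w := x) (by simp [vertexCoord_self]) with rfl | rfl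
    · rcases eq_or_ne v x with rfl | hv
      · simp [hself]
      · simp [vertexCoord_of_ne hv]
    · rw [vertexCoord_self, one_mul]
      rcases h.1 with rfl | h
      · simp [hself]
      · exact (hd _ _ h).1.symm
  -- A vertex lies on several edges and an interior point on one edge in two orientations.
  -- Antisymmetry of `d` makes the two orientations agree.
  have hwd : ∀ (p : V → ℝ) u v u' v', G.OnEdge u v p → G.OnEdge u' v' p →
      f u + κ (p v * d u v) = f u' + κ (p v' * d u' v') := by
    intro p u v u' v' h h'
    by_cases hp : ∃ x, p = vertexCoord x
    · obtain ⟨x, rfl⟩ := hp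
      rw [hvert u v x h, hvert u' v' x h']
    push Not at hp
    rcases h.unique h' hp with ⟨rfl, rfl⟩ | ⟨rfl, rfl⟩
    · rfl
    obtain ⟨huv, t, ht, rfl⟩ := onEdge_iff.1 h
    have hadj := huv.resolve_left (h.ne hp)
    rw [lineCoord_left hadj.ne, lineCoord_right hadj.ne, (hd _ _ hadj).1, hanti u' v', add_assoc,
      ← map_add]
    rw [hanti]
    ring_nf
  let F : G.MetricGraph → Z := fun p =>
    f p.2.choose + κ (p.1 p.2.choose_spec.choose * d p.2.choose p.2.choose_spec.choose)
  have hF : ∀ (p : G.MetricGraph) u v, G.OnEdge u v p.1 → F p = f u + κ (p.1 v * d u v) :=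
    fun p u v h => hwd p.1 _ _ _ _ p.2.choose_spec.choose_spec h
  have hFv : ∀ v, F (G.vertexPoint v) = f v := fun v => by
    rw [hF _ v v (onEdge_vertexCoord v), hself]; simp
  have hedge : ∀ p q : G.MetricGraph, EDist.edist (F p) (F q) ≤ G.edgeDist p.1 q.1 := by
    intro p q
    by_cases h : ∃ u v, G.OnEdge u v p.1 ∧ G.OnEdge u v q.1
    · obtain ⟨u, v, hp, hq⟩ := h
      -- On the edge `[u, v]` the parameter of a point is its coordinate at `v`, so this one
      -- coordinate controls `F`.
      refine le_trans ?_ (coord_le_edgeDist p.1 q.1 v)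
      rw [hF p u v hp, hF q u v hq, edist_add_left, edist_dist, edist_dist, dist_eq_norm,
        ← map_sub, ← sub_mul]
      apply ENNReal.ofReal_le_ofReal
      refine (hκ _).trans ?_
      rw [abs_mul, Real.dist_eq]
      have : |d u v| ≤ 1 := by
        rcases hp.1 with rfl | h
        · simp [hself]
        · exact (hd _ _ h).2
      exact mul_le_of_le_one_right (abs_nonneg _) this
    · simp [edgeDist, if_neg h]
  have hv : ∀ u v, EDist.edist (f u) (f v) ≤ ((G.edist u v : ℕ∞) : ℝ≥0∞) := by
    apply edist_map_le_edist
    intro u v h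
    obtain ⟨h1, h2⟩ := hd u v h
    rw [h1, edist_dist, dist_self_add_right]
    exact ENNReal.ofReal_le_one.2 ((hκ _).trans h2)
  refine ⟨F, ?_, hFv, ?_⟩
  · intro p q
    rw [ENNReal.coe_one, one_mul]
    refine le_min (hedge p q) (le_iInf fun u => le_iInf fun v => ?_)
    refine (edist_triangle4 (F p) (f u) (f v) (F q)).trans ?_
    refine add_le_add (add_le_add ?_ (hv u v)) ?_
    · have := hedge p (G.vertexPoint u)
      rwa [hFv] at this
    · have := hedge (G.vertexPoint v) q
      rwa [hFv] at this
  · intro u v h t ht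
    rw [hF _ u v (onEdge_lineCoord (Or.inr h) ht)]
    simp [edgePoint, lineCoord_right h.ne]

/-- The extension of the indicator of `u` is `1`-Lipschitz and takes the values `1` and `0` at the
two vertices. -/
lemma one_le_edist_vertexPoint {u v : V} (h : u ≠ v) :
    1 ≤ EDist.edist (G.vertexPoint u) (G.vertexPoint v) := by
  have h1 : ∀ a b, EDist.edist ((vertexCoord u : V → ℝ) a) ((vertexCoord u : V → ℝ) b) ≤ 1 := by
    intro a b
    rw [edist_dist, Real.dist_eq]
    have : |(vertexCoord u : V → ℝ) a - (vertexCoord u : V → ℝ) b| ≤ 1 := by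
      have hc : ∀ a, (vertexCoord u : V → ℝ) a = 0 ∨ (vertexCoord u : V → ℝ) a = 1 := by
        intro a
        by_cases ha : a = u
        · exact Or.inr (ha ▸ vertexCoord_self a)
        · exact Or.inl (vertexCoord_of_ne ha)
      rcases hc a with h | h <;> rcases hc b with h' | h' <;> simp [h, h']
    simpa using ENNReal.ofReal_le_ofReal this
  obtain ⟨F, hF, hFv, -⟩ := exists_lipschitz_extension (G := G) (AddMonoidHom.id ℝ)
    (fun x => le_rfl) (vertexCoord u) (fun a b => vertexCoord u b - vertexCoord u a)
    (fun _ _ => by ring) (fun a b _ => ⟨by simp, by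
      have := h1 b a
      rw [edist_dist, Real.dist_eq] at this
      simpa using this⟩)
  have := hF.edist_le_mul (G.vertexPoint u) (G.vertexPoint v)
  rw [hFv, hFv, vertexCoord_self, vertexCoord_of_ne h.symm] at this
  simpa [edist_dist] using this

end MetricGraphBasics


/-! ### Lower bound: gated cycles are isometrically embedded circles. -/

section GatedCycles

variable {V : Type*} {G : SimpleGraph V}

/-- A cycle of length `n`, together with a retraction `gate` of the graph onto it that collapses
every edge outside the cycle. -/
structure GatedCycle (G : SimpleGraph V) (n : ℕ) where
  vert : ZMod n → V
  gate : V → ZMod n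
  three_le : 3 ≤ n
  gate_vert : ∀ i, gate (vert i) = i
  adj_vert : ∀ i, G.Adj (vert i) (vert (i + 1))
  gate_eq_or : ∀ a b, G.Adj a b → gate a = gate b ∨
    (a = vert (gate a) ∧ b = vert (gate b) ∧ (gate b = gate a + 1 ∨ gate a = gate b + 1))

namespace GatedCycle

variable {n : ℕ} (C : GatedCycle G n)

/-- The closed curve of period `n` that runs through the cycle at unit speed. -/
noncomputable def loop (r : ℝ) : G.MetricGraph :=
  edgePoint (C.adj_vert (⌊r⌋ : ZMod n)) (Int.fract r) ⟨Int.fract_nonneg r, (Int.fract_lt_one r).le⟩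

lemma loop_intCast (k : ℤ) : C.loop k = G.vertexPoint (C.vert k) := by
  apply Subtype.ext
  simp [loop, edgePoint, lineCoord_zero, vertexPoint]

lemma loop_add (k : ℤ) {t : ℝ} (ht : t ∈ Set.Icc (0 : ℝ) 1) :
    C.loop (k + t) = edgePoint (C.adj_vert (k : ZMod n)) t ht := by
  rcases eq_or_lt_of_le ht.2 with rfl | h
  · rw [edgePoint_one]
    exact_mod_cast C.loop_intCast (k + 1)
  · have h1 : ⌊(k : ℝ) + t⌋ = k := by
      rw [Int.floor_intCast_add, Int.floor_eq_zero_iff.2 ⟨ht.1, h⟩, add_zero]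
    have h2 : Int.fract ((k : ℝ) + t) = t := by
      rw [Int.fract_intCast_add, Int.fract_eq_self.2 ⟨ht.1, h⟩]
    apply Subtype.ext
    simp [loop, edgePoint, h1, h2]

lemma loop_add_period (r : ℝ) : C.loop (r + n) = C.loop r := by
  apply Subtype.ext
  simp [loop, edgePoint]

lemma edist_vertexPoint_vert_le (i : ZMod n) (k : ℕ) :
    EDist.edist (G.vertexPoint (C.vert i)) (G.vertexPoint (C.vert (i + k))) ≤ (k : ℝ≥0∞) := by
  induction k with
  | zero => simp
  | succ k ih =>
    refine (PseudoEMetricSpace.edist_triangle _ (G.vertexPoint (C.vert (i + k))) _).trans ?_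
    push_cast
    refine add_le_add ih ?_
    rw [← add_assoc, ← edgePoint_zero (C.adj_vert (i + k)) (by simp),
      ← edgePoint_one (C.adj_vert (i + k)) (by simp)]
    refine (edist_edgePoint_le _ _ _).trans ?_
    simp

lemma edist_loop_add_le (k : ℤ) {s t : ℝ} (hs : s ∈ Set.Icc (0 : ℝ) 1)
    (ht : t ∈ Set.Icc (0 : ℝ) 1) :
    EDist.edist (C.loop (k + s)) (C.loop (k + t)) ≤ ENNReal.ofReal |s - t| := by
  rw [C.loop_add k hs, C.loop_add k ht]
  exact edist_edgePoint_le _ _ _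

/-- The curve has unit speed on each edge; cutting `[a, b]` at its integers and adding up the pieces
gives the bound. -/
lemma edist_loop_le (a b : ℝ) :
    EDist.edist (C.loop a) (C.loop b) ≤ ENNReal.ofReal |a - b| := by
  wlog hab : a ≤ b generalizing a b
  · rw [PseudoEMetricSpace.edist_comm, abs_sub_comm]
    exact this b a (le_of_not_ge hab)
  have hfa : Int.fract a ∈ Set.Icc (0 : ℝ) 1 := ⟨Int.fract_nonneg a, (Int.fract_lt_one a).le⟩
  have hfb : Int.fract b ∈ Set.Icc (0 : ℝ) 1 := ⟨Int.fract_nonneg b, (Int.fract_lt_one b).le⟩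
  have ha := Int.floor_add_fract a
  have hb := Int.floor_add_fract b
  have h0 : (0 : ℝ) ∈ Set.Icc (0 : ℝ) 1 := by simp
  have h1 : (1 : ℝ) ∈ Set.Icc (0 : ℝ) 1 := by simp
  rcases (Int.floor_mono hab).eq_or_lt with h | h
  · have := C.edist_loop_add_le ⌊a⌋ hfa hfb
    rw [ha, h, hb] at this
    convert this using 3
    unfold Int.fract
    rw [h]
    ring
  · obtain ⟨k, hk⟩ := Int.exists_add_of_le (Int.add_one_le_iff.2 h)
    have e1 := C.edist_loop_add_le ⌊a⌋ hfa h1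
    have e2 := C.edist_vertexPoint_vert_le ((⌊a⌋ + 1 : ℤ) : ZMod n) k
    have e3 := C.edist_loop_add_le ⌊b⌋ h0 hfb
    rw [ha] at e1
    rw [hb] at e3
    have hk' : ((⌊a⌋ + 1 : ℤ) : ZMod n) + (k : ZMod n) = (⌊b⌋ : ZMod n) := by
      rw [hk]; push_cast; rfl
    rw [hk', ← C.loop_intCast, ← C.loop_intCast] at e2
    push_cast at e2
    rw [add_zero] at e3
    refine (edist_triangle4 _ _ _ _).trans ((add_le_add (add_le_add e1 e2) e3).trans ?_)
    have hkr : (⌊b⌋ : ℝ) = ⌊a⌋ + 1 + k := by exact_mod_cast hk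
    rw [← ENNReal.ofReal_natCast, ← ENNReal.ofReal_add (abs_nonneg _) (Nat.cast_nonneg _),
      ← ENNReal.ofReal_add (by positivity) (abs_nonneg _)]
    apply ENNReal.ofReal_le_ofReal
    rw [abs_of_nonpos (by linarith [hfa.2]), abs_of_nonpos (by linarith [hfb.1]),
      abs_of_nonpos (by linarith)]
    linarith

/-- The retraction of the metric graph onto the cycle. -/
theorem exists_lipschitz_retraction : ∃ F : G.MetricGraph → AddCircle (n : ℝ),
    LipschitzWith 1 F ∧ ∀ r : ℝ, F (C.loop r) = (r : AddCircle (n : ℝ)) := by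
  classical
  let κ : ℝ →+ AddCircle (n : ℝ) := QuotientAddGroup.mk' _
  have hκn : κ n = 0 := AddCircle.coe_period _
  -- The vertices of the cycle go to the integer points of the circle.
  let ι : ZMod n →+ AddCircle (n : ℝ) := ZMod.lift n ⟨κ.comp (Int.castAddHom ℝ), by simpa using hκn⟩
  have hι : ∀ k : ℤ, ι k = κ k := fun k => by simp [ι, ZMod.lift_coe]
  have hι1 : ι 1 = κ 1 := by simpa using hι 1
  -- This is where `3 ≤ n` matters: a forward step along the cycle differs from a backward one, so
  -- the signed displacement `d` is antisymmetric.
  have hne : (1 : ZMod n) ≠ -1 := by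
    intro h
    have h2 : ((2 : ℕ) : ZMod n) = 0 := by
      push_cast
      linear_combination h
    have := Nat.le_of_dvd (by norm_num) ((ZMod.natCast_eq_zero_iff 2 n).1 h2)
    have := C.three_le
    omega
  let d : V → V → ℝ := fun u v =>
    if C.gate v = C.gate u + 1 then 1 else if C.gate u = C.gate v + 1 then -1 else 0
  have hn1 : (1 : ZMod n) ≠ 0 := by
    intro h
    apply hne
    rw [h, neg_zero]
  obtain ⟨F, hF, hFv, hFe⟩ := exists_lipschitz_extension (G := G) κ
    (fun x => QuotientAddGroup.norm_mk_le_norm) (fun v => ι (C.gate v)) d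
    (by
      intro u v
      simp only [d]
      by_cases h1 : C.gate v = C.gate u + 1 <;> by_cases h2 : C.gate u = C.gate v + 1
      · exfalso
        apply hne
        linear_combination -h1 - h2
      · simp only [if_pos h1, if_neg h2]
      · simp only [if_pos h2, if_neg h1, neg_neg]
      · simp [if_neg h1, if_neg h2])
    (by
      intro u v h
      simp only [d]
      rcases C.gate_eq_or u v h with h | ⟨-, -, h | h⟩
      · rw [h]
        simp [hn1]
      · rw [if_pos h, h]
        simp [hι1]
      · have h1 : ¬ C.gate v = C.gate u + 1 := by
          intro h1
          apply hne
          linear_combination -h - h1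
        rw [if_neg h1, if_pos h, h]
        simp [hι1])
  refine ⟨F, hF, fun r => ?_⟩
  refine (hFe _ _ (C.adj_vert (⌊r⌋ : ZMod n)) (Int.fract r)
    ⟨Int.fract_nonneg r, (Int.fract_lt_one r).le⟩).trans ?_
  simp only [d, C.gate_vert, if_pos]
  rw [hι, mul_one, ← map_add, Int.floor_add_fract]
  rfl

/-- The retraction does not increase distances, and on a circle of length `n` the distance is `|a -
b|` as long as this is at most `n / 2`. -/
lemma edist_loop_eq {a b : ℝ} (h : |a - b| ≤ n / 2) :
    EDist.edist (C.loop a) (C.loop b) = ENNReal.ofReal |a - b| := by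
  refine le_antisymm (C.edist_loop_le a b) ?_
  obtain ⟨F, hF, hFl⟩ := C.exists_lipschitz_retraction
  have := hF.edist_le_mul (C.loop a) (C.loop b)
  rw [ENNReal.coe_one, one_mul, hFl, hFl, edist_dist, dist_eq_norm, ← AddCircle.coe_sub,
    (AddCircle.norm_coe_eq_abs_iff _ (Nat.cast_ne_zero.2 (by have := C.three_le; omega))).2
      (by rwa [Nat.abs_cast])] at this
  exact this

lemma isGeodesicSegment_loop (a : ℝ) {L : ℝ} (h0 : 0 ≤ L) (hL : L ≤ n / 2) :
    IsGeodesicSegment (C.loop a) (C.loop (a + L)) (C.loop '' Set.Icc a (a + L)) := by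
  refine ⟨L, fun s => C.loop (a + s), h0, by simp, rfl, ?_, ?_⟩
  · intro s hs t ht
    rw [C.edist_loop_eq]
    · simp
    · rw [add_sub_add_left_eq_sub]
      exact (abs_sub_le_of_nonneg_of_le hs.1 hs.2 ht.1 ht.2).trans hL
  · rw [show (fun s => C.loop (a + s)) = C.loop ∘ (fun s => a + s) from rfl, Set.image_comp,
      Set.image_const_add_Icc, add_zero]

/-- A cycle of length `n` onto which the graph retracts gives rise to a geodesic bigon that is not
`d`-thin for `d < n / 4`. -/
theorem le_hyperbolicityConstant (C : GatedCycle G n) :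
    (n : ℝ≥0∞) / 4 ≤ hyperbolicityConstant G.MetricGraph := by
  have hn : (0 : ℝ) ≤ n := Nat.cast_nonneg n
  have hA := C.isGeodesicSegment_loop 0 (L := n / 2) (by positivity) le_rfl
  have hB := C.isGeodesicSegment_loop (0 + n / 2) (L := n / 2) (by positivity) le_rfl
  -- The third side is degenerate, so the triangle is a bigon.
  have hC := C.isGeodesicSegment_loop 0 (L := 0) le_rfl (by positivity)
  have hend : C.loop (0 + n / 2 + n / 2) = C.loop 0 := by
    rw [← C.loop_add_period 0]
    ring_nf
  have hend' : C.loop (0 + 0) = C.loop 0 := by rw [add_zero]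
  rw [hend] at hB
  rw [hend'] at hC
  have htri : IsGeodesicTriangle _ _ _ := ⟨_, _, _, hA, hB, hC⟩
  refine le_trans ?_ (le_iSup_of_le _ (le_iSup_of_le _ (le_iSup_of_le _ (le_iSup_of_le htri le_rfl))))
  refine le_iInf fun d => le_iInf fun hd => ?_
  refine le_trans ?_ (hd.1 (C.loop (n / 4)) ⟨n / 4, ⟨by positivity, by linarith⟩, rfl⟩)
  rw [Metric.le_infEDist]
  have key : ∀ s : ℝ, n / 2 ≤ s → s ≤ n →
      (n : ℝ≥0∞) / 4 ≤ EDist.edist (C.loop (n / 4)) (C.loop s) := by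
    intro s h1 h2
    obtain ⟨F, hF, hFl⟩ := C.exists_lipschitz_retraction
    have := hF.edist_le_mul (C.loop (n / 4)) (C.loop s)
    rw [ENNReal.coe_one, one_mul, hFl, hFl, edist_dist, dist_eq_norm, ← AddCircle.coe_sub] at this
    refine le_trans ?_ this
    have h4 : (n : ℝ≥0∞) / 4 = ENNReal.ofReal (n / 4) := by
      rw [ENNReal.ofReal_div_of_pos (by norm_num)]
      simp
    rw [h4]
    apply ENNReal.ofReal_le_ofReal
    rw [AddCircle.norm_eq]
    -- The nearest multiple need not be computed: as `n / 4 - s` lies in `[-3n / 4, -n / 4]`, every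
    -- translate by a multiple of `n` has absolute value at least `n / 4`.
    generalize round ((n : ℝ)⁻¹ * (n / 4 - s)) = k
    rcases le_or_gt 0 k with hk | hk
    · have hk' : (0 : ℝ) ≤ k := by exact_mod_cast hk
      rw [le_abs]
      right
      nlinarith [mul_nonneg hk' hn]
    · have hk' : (k : ℝ) ≤ -1 := by exact_mod_cast (by omega : k ≤ -1)
      rw [le_abs]
      left
      nlinarith [mul_nonneg (by linarith : 0 ≤ -1 - (k : ℝ)) hn]
  rintro _ (⟨s, hs, rfl⟩ | ⟨s, hs, rfl⟩)
  · exact key s (by linarith [hs.1]) (by linarith [hs.2])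
  · have : s = 0 := by linarith [hs.1, hs.2]
    rw [this, ← C.loop_add_period 0]
    exact key _ (by linarith) (by linarith)

end GatedCycle

end GatedCycles

end SimpleGraph

/-! ### Geodesics and connected sets through their ends. -/

lemma lt_iff_lt_of_isPreconnected {X : Type*} [TopologicalSpace X] {T : Set X}
    (hT : IsPreconnected T) {f : X → ℝ} (hf : ContinuousOn f T) {τ : ℝ} (hne : ∀ x ∈ T, f x ≠ τ)
    {x y : X} (hx : x ∈ T) (hy : y ∈ T) : f x < τ ↔ f y < τ := by
  have key : ∀ {x y : X}, x ∈ T → y ∈ T → f x < τ → f y < τ := by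
    intro x y hx hy h
    by_contra hc
    obtain ⟨z, hz, hzτ⟩ := hT.intermediate_value hx hy hf ⟨h.le, not_lt.1 hc⟩
    exact hne z hz hzτ
  exact ⟨key hx hy, key hy hx⟩

section Geodesics

variable {X : Type*} [EMetricSpace X] {L : ℝ} {γ : ℝ → X}

lemma continuousOn_of_edist_eq
    (hγ : ∀ s ∈ Set.Icc 0 L, ∀ t ∈ Set.Icc 0 L, edist (γ s) (γ t) = ENNReal.ofReal |s - t|) :
    ContinuousOn γ (Set.Icc 0 L) := by
  have : LipschitzOnWith 1 γ (Set.Icc 0 L) := by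
    intro s hs t ht
    rw [hγ s hs t ht, ENNReal.coe_one, one_mul, edist_dist, Real.dist_eq]
  exact this.continuousOn

lemma injOn_of_edist_eq
    (hγ : ∀ s ∈ Set.Icc 0 L, ∀ t ∈ Set.Icc 0 L, edist (γ s) (γ t) = ENNReal.ofReal |s - t|) :
    Set.InjOn γ (Set.Icc 0 L) := by
  intro s hs t ht h
  have := hγ s hs t ht
  rw [h, edist_self, eq_comm, ENNReal.ofReal_eq_zero] at this
  linarith [abs_eq_zero.1 (le_antisymm this (abs_nonneg _))]

lemma IsGeodesicSegment.isPreconnected {x y : X} {S : Set X} (h : IsGeodesicSegment x y S) :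
    IsPreconnected S := by
  obtain ⟨L, γ, -, -, -, hγ, rfl⟩ := h
  exact isPreconnected_Icc.image _ (continuousOn_of_edist_eq hγ)

lemma IsGeodesicSegment.left_mem {x y : X} {S : Set X} (h : IsGeodesicSegment x y S) : x ∈ S := by
  obtain ⟨L, γ, h0, h1, -, -, rfl⟩ := h
  exact ⟨0, ⟨le_rfl, h0⟩, h1⟩

lemma IsGeodesicSegment.right_mem {x y : X} {S : Set X} (h : IsGeodesicSegment x y S) :
    y ∈ S := by
  obtain ⟨L, γ, h0, -, h1, -, rfl⟩ := h
  exact ⟨L, ⟨h0, le_rfl⟩, h1⟩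

lemma LipschitzWith.abs_sub_le_of_edist_le {f : X → ℝ} (hf : LipschitzWith 1 f) {p q : X} {r : ℝ}
    (hr : 0 ≤ r) (h : edist p q ≤ ENNReal.ofReal r) : |f p - f q| ≤ r := by
  have := hf.edist_le_mul p q
  rw [ENNReal.coe_one, one_mul] at this
  replace this := this.trans h
  rwa [edist_dist, Real.dist_eq, ENNReal.ofReal_le_ofReal_iff hr] at this

/-- A space is `d`-hyperbolic if every geodesic is in the `d`-neighbourhood of every preconnected
set that contains its ends. -/
lemma hyperbolicityConstant_le {d : ℝ≥0}
    (h : ∀ (x y : X) (a S : Set X), IsGeodesicSegment x y a → IsPreconnected S → x ∈ S → y ∈ S →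
      ∀ p ∈ a, Metric.infEDist p S ≤ d) : hyperbolicityConstant X ≤ d := by
  refine iSup_le fun a => iSup_le fun b => iSup_le fun c => iSup_le ?_
  rintro ⟨x, y, z, ha, hb, hc⟩
  refine iInf_le_of_le d (iInf_le_of_le ⟨?_, ?_, ?_⟩ le_rfl)
  · exact h x y a _ ha (hb.isPreconnected.union z hb.right_mem hc.left_mem hc.isPreconnected)
      (Or.inr hc.right_mem) (Or.inl hb.left_mem)
  · exact h y z b _ hb (hc.isPreconnected.union x hc.right_mem ha.left_mem ha.isPreconnected)
      (Or.inr ha.right_mem) (Or.inl hc.left_mem)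
  · exact h z x c _ hc (ha.isPreconnected.union y ha.right_mem hb.left_mem hb.isPreconnected)
      (Or.inr hb.right_mem) (Or.inl ha.left_mem)

end Geodesics

namespace SimpleGraph

/-! ### Upper bound: geodesics near bridges and gated cycles. -/

section UpperBound

variable {V : Type*} {G : SimpleGraph V}

/-- The ends of the edge `uv` are separated by removing that edge. -/
def IsSplit (G : SimpleGraph V) (u v : V) : Prop :=
  ∃ h : V → ℝ, (∀ a, h a = 0 ∨ h a = 1) ∧ h u = 0 ∧ h v = 1 ∧
    ∀ a b, G.Adj a b → h a ≠ h b → s(a, b) = s(u, v)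

theorem exists_affine_extension (h : V → ℝ) (hh : ∀ a b, G.Adj a b → |h b - h a| ≤ 1) :
    ∃ H : G.MetricGraph → ℝ, LipschitzWith 1 H ∧ (∀ v, H (G.vertexPoint v) = h v) ∧
      ∀ u v (e : G.Adj u v) (t : ℝ) (ht : t ∈ Set.Icc (0 : ℝ) 1),
        H (edgePoint e t ht) = h u + t * (h v - h u) :=
  exists_lipschitz_extension (AddMonoidHom.id ℝ) (fun _ => le_rfl) h (fun a b => h b - h a)
    (fun _ _ => by ring) fun a b e => ⟨by simp, hh a b e⟩

/-- The extension `H` of the separating function takes the value `τ` only at the given point. A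
geodesic visits this point once and crosses it along the edge, so its two ends lie on different
sides of the level `τ`. A connected set containing both ends must meet this level. -/
lemma IsSplit.mem_of_isPreconnected {u v : V} (hs : G.IsSplit u v) (huv : G.Adj u v) {τ : ℝ}
    (hτ : τ ∈ Set.Ioo (0 : ℝ) 1) {L : ℝ} {γ : ℝ → G.MetricGraph}
    (hγ : ∀ s ∈ Set.Icc 0 L, ∀ t ∈ Set.Icc 0 L, EDist.edist (γ s) (γ t) = ENNReal.ofReal |s - t|)
    {S : Set G.MetricGraph} (hS : IsPreconnected S) (h0 : γ 0 ∈ S) (hL : γ L ∈ S) {t₀ : ℝ}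
    (ht₀ : t₀ ∈ Set.Icc 0 L) (hp : γ t₀ = edgePoint huv τ (Set.Ioo_subset_Icc_self hτ)) :
    γ t₀ ∈ S := by
  obtain ⟨h, h01, hu, hv, hab⟩ := hs
  obtain ⟨H, hH, hHv, hHe⟩ := exists_affine_extension (G := G) h (by
    intro a b _
    rcases h01 a with ha | ha <;> rcases h01 b with hb | hb <;> simp [ha, hb])
  have hloc : ∀ q, H q ∈ Set.Ioo (0 : ℝ) 1 → ∃ (r : ℝ) (hr : r ∈ Set.Icc (0 : ℝ) 1),
      q = edgePoint huv r hr ∧ H q = r := by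
    intro q hq
    rcases eq_vertexPoint_or_edgePoint q with ⟨w, rfl⟩ | ⟨a, b, e, t, ht, rfl⟩
    · rw [hHv] at hq
      rcases h01 w with hw | hw <;> [linarith [hq.1]; linarith [hq.2]]
    · rw [hHe] at hq ⊢
      have hne : h a ≠ h b := by
        intro hne
        rw [hne] at hq
        rcases h01 b with hw | hw <;> [linarith [hq.1]; linarith [hq.2]]
      rcases Sym2.eq_iff.1 (hab a b e hne) with ⟨rfl, rfl⟩ | ⟨rfl, rfl⟩
      · exact ⟨t, Set.Ioo_subset_Icc_self ht, rfl, by rw [hu, hv]; ring⟩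
      · exact ⟨1 - t, ⟨by linarith [ht.2], by linarith [ht.1]⟩, edgePoint_symm e _,
          by rw [hu, hv]; ring⟩
  have hfib : ∀ q, H q = τ → q = γ t₀ := by
    intro q hq
    obtain ⟨r, hr, rfl, hHr⟩ := hloc q (hq ▸ hτ)
    obtain rfl : r = τ := hHr.symm.trans hq
    exact hp.symm
  have hHp : H (γ t₀) = τ := by rw [hp, hHe, hu, hv]; ring
  have hinj := injOn_of_edist_eq hγ
  have hcont : ContinuousOn (H ∘ γ) (Set.Icc 0 L) :=
    hH.continuous.comp_continuousOn (continuousOn_of_edist_eq hγ)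
  by_contra hpS
  have hne0 : t₀ ≠ 0 := fun hc => hpS (hc ▸ h0)
  have hneL : t₀ ≠ L := fun hc => hpS (hc ▸ hL)
  have ht0 : 0 < t₀ := lt_of_le_of_ne ht₀.1 hne0.symm
  have htL : t₀ < L := lt_of_le_of_ne ht₀.2 hneL
  obtain ⟨ε, hε0, hε⟩ := exists_between
    (lt_min (lt_min hτ.1 (sub_pos.2 hτ.2)) (lt_min ht0 (sub_pos.2 htL)))
  simp only [lt_min_iff] at hε
  obtain ⟨⟨hε1, hε2⟩, hε3, hε4⟩ := hε
  have hm1 : t₀ - ε ∈ Set.Icc 0 L := ⟨by linarith, by linarith⟩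
  have hm2 : t₀ + ε ∈ Set.Icc 0 L := ⟨by linarith, by linarith⟩
  have hd1 : |H (γ (t₀ - ε)) - τ| ≤ ε := by
    rw [← hHp]
    refine hH.abs_sub_le_of_edist_le hε0.le ?_
    rw [hγ _ hm1 _ ht₀, sub_sub_cancel_left, abs_neg, abs_of_pos hε0]
  have hd2 : |H (γ (t₀ + ε)) - τ| ≤ ε := by
    rw [← hHp]
    refine hH.abs_sub_le_of_edist_le hε0.le ?_
    rw [hγ _ hm2 _ ht₀, add_sub_cancel_left, abs_of_pos hε0]
  rw [abs_le] at hd1 hd2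
  obtain ⟨r1, hr1, hq1, hr1'⟩ := hloc (γ (t₀ - ε)) ⟨by linarith, by linarith⟩
  obtain ⟨r2, hr2, hq2, hr2'⟩ := hloc (γ (t₀ + ε)) ⟨by linarith, by linarith⟩
  -- Both parameters are within `ε` of `τ`; being at least `2 * ε` apart, they lie on opposite sides
  -- of `τ`.
  have hdist : 2 * ε ≤ |r2 - r1| := by
    have := hγ _ hm2 _ hm1
    rw [hq1, hq2] at this
    have h3 := this.symm.le.trans (edist_edgePoint_le huv hr2 hr1)
    rw [ENNReal.ofReal_le_ofReal_iff (abs_nonneg _)] at h3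
    refine le_trans ?_ h3
    rw [show t₀ + ε - (t₀ - ε) = 2 * ε by ring]
    exact le_abs_self _
  rw [hr1'] at hd1
  rw [hr2'] at hd2
  have e1 := lt_iff_lt_of_isPreconnected (T := Set.Icc 0 (t₀ - ε)) (f := H ∘ γ) (τ := τ)
    isPreconnected_Icc (hcont.mono (Set.Icc_subset_Icc_right hm1.2))
    (fun s hs hc => by
      have := hinj ⟨hs.1, hs.2.trans hm1.2⟩ ht₀ (hfib _ hc)
      linarith [hs.2]) (Set.left_mem_Icc.2 hm1.1) (Set.right_mem_Icc.2 hm1.1)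
  have e2 := lt_iff_lt_of_isPreconnected (T := Set.Icc (t₀ + ε) L) (f := H ∘ γ) (τ := τ)
    isPreconnected_Icc (hcont.mono (Set.Icc_subset_Icc_left hm2.1))
    (fun s hs hc => by
      have := hinj ⟨hm2.1.trans hs.1, hs.2⟩ ht₀ (hfib _ hc)
      linarith [hs.1]) (Set.left_mem_Icc.2 hm2.2) (Set.right_mem_Icc.2 hm2.2)
  have e3 := lt_iff_lt_of_isPreconnected hS (f := H) (τ := τ) hH.continuous.continuousOn
    (fun s hs hc => hpS (hfib s hc ▸ hs)) h0 hL
  simp only [Function.comp_apply, hr1', hr2'] at e1 e2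
  have e4 : r1 < τ ↔ r2 < τ := by rw [← e1, e2, e3]
  rcases abs_cases (r2 - r1) with ⟨h5, -⟩ | ⟨h5, -⟩
  · have := e4.1 (by linarith)
    linarith
  · have := e4.2 (by linarith)
    linarith

namespace GatedCycle

variable {n : ℕ} (C : GatedCycle G n)

lemma edgePoint_mem_range_loop {i : ZMod n} {t : ℝ} (ht : t ∈ Set.Icc (0 : ℝ) 1) :
    edgePoint (C.adj_vert i) t ht ∈ Set.range C.loop := by
  obtain ⟨k, rfl⟩ := ZMod.intCast_surjective i
  exact ⟨k + t, C.loop_add k ht⟩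

lemma vertexPoint_mem_range_loop (i : ZMod n) : G.vertexPoint (C.vert i) ∈ Set.range C.loop := by
  obtain ⟨k, rfl⟩ := ZMod.intCast_surjective i
  exact ⟨k, C.loop_intCast k⟩

/-- A point `q` off the cycle is separated from it by a vertex `C.vert j` of the cycle. -/
theorem exists_separation {q : G.MetricGraph} (hq : q ∉ Set.range C.loop) :
    ∃ (j : ZMod n) (H : G.MetricGraph → ℝ), LipschitzWith 1 H ∧ (∀ r, H (C.loop r) ≤ 0) ∧
      (∀ p, H p = 0 → p = G.vertexPoint (C.vert j)) ∧ 0 < H q := by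
  classical
  have key : ∀ j : ZMod n, ∃ H : G.MetricGraph → ℝ, LipschitzWith 1 H ∧
      (∀ r, H (C.loop r) ≤ 0) ∧ (∀ p, H p = 0 → p = G.vertexPoint (C.vert j)) ∧
      (∀ v, C.gate v = j → v ≠ C.vert j → 0 < H (G.vertexPoint v)) ∧
      (∀ a b (e : G.Adj a b) t (ht : t ∈ Set.Ioo (0 : ℝ) 1), C.gate a = j → C.gate b = j →
        0 < H (edgePoint e t (Set.Ioo_subset_Icc_self ht))) := by
    intro j
    -- The sign tells the two sides of `C.vert j` apart: positive on the rest of its branch,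
    -- negative at all vertices with another gate. No edge joins `1` to `-1`, and only `C.vert j`
    -- has value `0`, so the extension vanishes nowhere else.
    let h : V → ℝ := fun v => if C.gate v = j then (if v = C.vert j then 0 else 1) else -1
    have hvert : ∀ i, h (C.vert i) = 0 ∨ h (C.vert i) = -1 := by
      intro i
      simp only [h, C.gate_vert]
      by_cases hi : i = j <;> simp [hi]
    have hgate : ∀ v, C.gate v = j → h v = 0 ∨ h v = 1 := by
      intro v hv
      simp only [h, hv]
      by_cases hi : v = C.vert j <;> simp [hi]
    have hngate : ∀ v, C.gate v ≠ j → h v = -1 := fun v hv => if_neg hv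
    have hzero : ∀ v, h v = 0 → v = C.vert j := by
      intro v hv
      by_contra hne
      simp only [h, hne] at hv
      by_cases hi : C.gate v = j <;> simp [hi] at hv
    have hadj : ∀ a b, G.Adj a b → (h a = -1 ∧ h b = -1) ∨
        (0 ≤ h a ∧ 0 ≤ h b ∧ h a ≤ 1 ∧ h b ≤ 1) ∨
        (-1 ≤ h a ∧ -1 ≤ h b ∧ h a ≤ 0 ∧ h b ≤ 0) := by
      intro a b e
      rcases C.gate_eq_or a b e with hab | ⟨ha, hb, -⟩
      · by_cases hj : C.gate b = j
        · rcases hgate b hj with h1 | h1 <;> rcases hgate a (hab.trans hj) with h2 | h2 <;>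
            simp [h1, h2]
        · exact Or.inl ⟨hngate a (hab ▸ hj), hngate b hj⟩
      · have h1 := hvert (C.gate a)
        have h2 := hvert (C.gate b)
        rw [← ha] at h1
        rw [← hb] at h2
        rcases h1 with h1 | h1 <;> rcases h2 with h2 | h2 <;> simp [h1, h2]
    have hnz : ∀ a b, G.Adj a b → h a ≠ 0 ∨ h b ≠ 0 := by
      intro a b e
      by_contra! hc
      exact e.ne ((hzero a hc.1).trans (hzero b hc.2).symm)
    obtain ⟨H, hH, hHv, hHe⟩ := exists_affine_extension (G := G) h (by
      intro a b e
      rw [abs_le]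
      rcases hadj a b e with h1 | h1 | h1 <;> constructor <;> linarith)
    have hconv : ∀ a b, G.Adj a b → 0 ≤ h a → 0 ≤ h b → ∀ t ∈ Set.Ioo (0 : ℝ) 1,
        0 < h a + t * (h b - h a) := by
      intro a b e ha hb t ht
      have h1 : 0 ≤ (1 - t) * h a := mul_nonneg (by linarith [ht.2]) ha
      have h2 : 0 ≤ t * h b := mul_nonneg ht.1.le hb
      rcases hnz a b e with h3 | h3
      · have : 0 < (1 - t) * h a :=
          mul_pos (by linarith [ht.2]) (lt_of_le_of_ne ha h3.symm)
        linarith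
      · have : 0 < t * h b := mul_pos ht.1 (lt_of_le_of_ne hb h3.symm)
        linarith
    have hconv' : ∀ a b, G.Adj a b → h a ≤ 0 → h b ≤ 0 → ∀ t ∈ Set.Ioo (0 : ℝ) 1,
        h a + t * (h b - h a) < 0 := by
      intro a b e ha hb t ht
      have h1 : 0 ≤ (1 - t) * (-h a) := mul_nonneg (by linarith [ht.2]) (by linarith)
      have h2 : 0 ≤ t * (-h b) := mul_nonneg ht.1.le (by linarith)
      rcases hnz a b e with h3 | h3
      · have : 0 < (1 - t) * (-h a) :=
          mul_pos (by linarith [ht.2]) (neg_pos.2 (lt_of_le_of_ne ha h3))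
        linarith
      · have : 0 < t * (-h b) := mul_pos ht.1 (neg_pos.2 (lt_of_le_of_ne hb h3))
        linarith
    refine ⟨H, hH, fun r => ?_, fun p hp => ?_, fun v hv hne => ?_, fun a b e t ht ha hb => ?_⟩
    · rw [loop]
      refine (hHe _ _ (C.adj_vert _) (Int.fract r)
        ⟨Int.fract_nonneg r, (Int.fract_lt_one r).le⟩).trans_le ?_
      have h1 : ∀ i, h (C.vert i) ≤ 0 := fun i => by
        rcases hvert i with h1 | h1 <;> rw [h1]
        norm_num
      nlinarith [h1 ⌊r⌋, h1 (⌊r⌋ + 1), Int.fract_nonneg r, Int.fract_lt_one r]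
    · rcases eq_vertexPoint_or_edgePoint p with ⟨w, rfl⟩ | ⟨a, b, e, t, ht, rfl⟩
      · rw [hHv] at hp
        rw [hzero w hp]
      · exfalso
        rw [hHe] at hp
        rcases hadj a b e with h1 | h1 | h1
        · exact (hconv' a b e (by linarith) (by linarith) t ht).ne hp
        · exact (hconv a b e h1.1 h1.2.1 t ht).ne' hp
        · exact (hconv' a b e h1.2.2.1 h1.2.2.2 t ht).ne hp
    · rw [hHv]
      simp [h, hv, hne]
    · rw [hHe]
      refine hconv a b e ?_ ?_ t ht
      · rcases hgate a ha with h1 | h1 <;> simp [h1]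
      · rcases hgate b hb with h1 | h1 <;> simp [h1]
  rcases eq_vertexPoint_or_edgePoint q with ⟨w, rfl⟩ | ⟨a, b, e, t, ht, rfl⟩
  · obtain ⟨H, h1, h2, h3, h4, -⟩ := key (C.gate w)
    refine ⟨_, H, h1, h2, h3, h4 w rfl fun hw => hq ?_⟩
    rw [hw]
    exact C.vertexPoint_mem_range_loop _
  · rcases C.gate_eq_or a b e with hab | ⟨ha, hb, hab⟩
    · obtain ⟨H, h1, h2, h3, -, h4⟩ := key (C.gate b)
      exact ⟨_, H, h1, h2, h3, h4 a b e t ht hab rfl⟩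
    · exfalso
      apply hq
      generalize C.gate a = i at *
      generalize C.gate b = j at *
      subst ha hb
      rcases hab with rfl | rfl
      · exact C.edgePoint_mem_range_loop _
      · rw [edgePoint_symm]
        exact C.edgePoint_mem_range_loop _

/-- If `γ` starts off the cycle, it must pass the vertex separating its start from the cycle before
it reaches `p`. If `S` missed this vertex, `γ L` would be on the side of `γ 0`, so `γ` would pass
the vertex again after `p`. A geodesic is injective, so `p` would be that vertex. -/
lemma exists_mem_before {p : G.MetricGraph} (hp : p ∈ Set.range C.loop)
    (hpv : ∀ v, p ≠ G.vertexPoint v) {L : ℝ} {γ : ℝ → G.MetricGraph}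
    (hγ : ∀ s ∈ Set.Icc 0 L, ∀ t ∈ Set.Icc 0 L, EDist.edist (γ s) (γ t) = ENNReal.ofReal |s - t|)
    {S : Set G.MetricGraph} (hS : IsPreconnected S) (h0 : γ 0 ∈ S) (hL : γ L ∈ S) {t₀ : ℝ}
    (ht₀ : t₀ ∈ Set.Icc 0 L) (hpt : γ t₀ = p) :
    ∃ t ∈ Set.Icc 0 t₀, γ t ∈ S ∧ γ t ∈ Set.range C.loop := by
  by_cases hx : γ 0 ∈ Set.range C.loop
  · exact ⟨0, ⟨le_rfl, ht₀.1⟩, h0, hx⟩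
  obtain ⟨j, H, hH, hHl, hH0, hHx⟩ := C.exists_separation hx
  have hcont : ContinuousOn (H ∘ γ) (Set.Icc 0 L) :=
    hH.continuous.comp_continuousOn (continuousOn_of_edist_eq hγ)
  have hHp : H p < 0 := by
    obtain ⟨r, rfl⟩ := hp
    exact lt_of_le_of_ne (hHl r) fun h => hpv _ (hH0 _ h)
  obtain ⟨t₁, ht₁, h1⟩ := isPreconnected_Icc.intermediate_value (Set.right_mem_Icc.2 ht₀.1)
    (Set.left_mem_Icc.2 ht₀.1) (hcont.mono (Set.Icc_subset_Icc_right ht₀.2))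
    (show (0 : ℝ) ∈ Set.Icc _ _ from ⟨by simp only [Function.comp_apply, hpt]; exact hHp.le, hHx.le⟩)
  have h1' := hH0 _ h1
  refine ⟨t₁, ht₁, ?_, h1' ▸ C.vertexPoint_mem_range_loop j⟩
  by_contra hc
  have e := lt_iff_lt_of_isPreconnected hS (f := H) (τ := 0) hH.continuous.continuousOn
    (fun s hs h => hc (by rw [h1', ← hH0 s h]; exact hs)) h0 hL
  have hy : 0 ≤ H (γ L) := not_lt.1 fun h => absurd (e.2 h) (not_lt.2 hHx.le)
  obtain ⟨t₂, ht₂, h2⟩ := isPreconnected_Icc.intermediate_value (Set.left_mem_Icc.2 ht₀.2)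
    (Set.right_mem_Icc.2 ht₀.2) (hcont.mono (Set.Icc_subset_Icc_left ht₀.1))
    (show (0 : ℝ) ∈ Set.Icc _ _ from ⟨by simp only [Function.comp_apply, hpt]; exact hHp.le, hy⟩)
  have h12 := injOn_of_edist_eq hγ ⟨ht₁.1, ht₁.2.trans ht₀.2⟩ ⟨ht₀.1.trans ht₂.1, ht₂.2⟩
    (h1'.trans (hH0 _ h2).symm)
  have : t₁ = t₀ := le_antisymm ht₁.2 (by rw [h12]; exact ht₂.1)
  exact hpv _ (by rw [← hpt, ← this, h1'])

lemma edist_le_half {p q : G.MetricGraph} (hp : p ∈ Set.range C.loop)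
    (hq : q ∈ Set.range C.loop) : EDist.edist p q ≤ ENNReal.ofReal (n / 2) := by
  obtain ⟨a, rfl⟩ := hp
  obtain ⟨b, rfl⟩ := hq
  have hn : (0 : ℝ) < n := by
    have := C.three_le
    exact_mod_cast (by omega : 0 < n)
  have hper : Function.Periodic C.loop n := C.loop_add_period
  -- Shift `a` by the multiple of `n` that brings it closest to `b`.
  rw [← hper.sub_int_mul_eq (round ((a - b) / n)) (x := a)]
  refine (C.edist_loop_le _ _).trans (ENNReal.ofReal_le_ofReal ?_)
  have := abs_sub_round ((a - b) / n)
  rw [show a - round ((a - b) / n) * n - b = ((a - b) / n - round ((a - b) / n)) * n by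
    field_simp; ring, abs_mul, abs_of_pos hn]
  nlinarith

/-- `exists_mem_before`, applied to the geodesic and to its reverse, gives points of `S` on the
cycle before and after `p`. The time between them is their distance, at most `n / 2`, so one of them
is within `n / 4` of `p`. -/
lemma infEDist_le {p : G.MetricGraph} (hp : p ∈ Set.range C.loop)
    (hpv : ∀ v, p ≠ G.vertexPoint v) {L : ℝ} {γ : ℝ → G.MetricGraph}
    (hγ : ∀ s ∈ Set.Icc 0 L, ∀ t ∈ Set.Icc 0 L, EDist.edist (γ s) (γ t) = ENNReal.ofReal |s - t|)
    {S : Set G.MetricGraph} (hS : IsPreconnected S) (h0 : γ 0 ∈ S) (hL : γ L ∈ S) {t₀ : ℝ}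
    (ht₀ : t₀ ∈ Set.Icc 0 L) (hpt : γ t₀ = p) :
    Metric.infEDist p S ≤ ENNReal.ofReal (n / 4) := by
  obtain ⟨t₁, ht₁, hS₁, hl₁⟩ := C.exists_mem_before hp hpv hγ hS h0 hL ht₀ hpt
  obtain ⟨t₂, ht₂, hS₂, hl₂⟩ := C.exists_mem_before (γ := fun s => γ (L - s)) (L := L)
    (t₀ := L - t₀) hp hpv
    (fun s hs t ht => by
      rw [hγ _ ⟨by linarith [hs.2], by linarith [hs.1]⟩ _ ⟨by linarith [ht.2], by linarith [ht.1]⟩,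
        sub_sub_sub_cancel_left, abs_sub_comm])
    hS (by simpa using hL) (by simpa using h0)
    ⟨by linarith [ht₀.2], by linarith [ht₀.1]⟩ (by simpa using hpt)
  have hm₁ : t₁ ∈ Set.Icc 0 L := ⟨ht₁.1, ht₁.2.trans ht₀.2⟩
  have hm₂ : L - t₂ ∈ Set.Icc 0 L := ⟨by linarith [ht₂.2, ht₀.1], by linarith [ht₂.1]⟩
  have hle := C.edist_le_half hl₂ hl₁
  rw [hγ _ hm₂ _ hm₁, ENNReal.ofReal_le_ofReal_iff (by positivity)] at hle
  have hle' := (le_abs_self _).trans hle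
  rcases le_or_gt (t₀ - t₁) (n / 4) with h | h
  · refine (Metric.infEDist_le_edist_of_mem hS₁).trans ?_
    rw [← hpt, hγ _ ht₀ _ hm₁]
    apply ENNReal.ofReal_le_ofReal
    rwa [abs_of_nonneg (by linarith [ht₁.2])]
  · refine (Metric.infEDist_le_edist_of_mem hS₂).trans ?_
    rw [← hpt, hγ _ ht₀ _ hm₂]
    apply ENNReal.ofReal_le_ofReal
    rw [abs_of_nonpos (by linarith [ht₂.2])]
    linarith

end GatedCycle

/-- If every edge is separating or lies on a gated cycle of length at most `N`, then the graph
is `N / 4`-hyperbolic. -/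
theorem hyperbolicityConstant_le_of_isSplit_or {N : ℕ}
    (h : ∀ u v, G.Adj u v → G.IsSplit u v ∨
      ∃ n ≤ N, ∃ (C : GatedCycle G n) (i : ZMod n), s(u, v) = s(C.vert i, C.vert (i + 1))) :
    hyperbolicityConstant G.MetricGraph ≤ (N : ℝ≥0∞) / 4 := by
  have h4 : ∀ n : ℕ, ENNReal.ofReal ((n : ℝ) / 4) = (n : ℝ≥0∞) / 4 := by
    intro n
    rw [ENNReal.ofReal_div_of_pos (by norm_num)]
    simp
  rw [← h4, ← ENNReal.ofNNReal_toNNReal]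
  apply hyperbolicityConstant_le
  rintro x y a S ⟨L, γ, hL, rfl, rfl, hγ, rfl⟩ hS hx hy _ ⟨t₀, ht₀, rfl⟩
  rw [ENNReal.ofNNReal_toNNReal]
  have main : ∀ t ∈ Set.Icc 0 L, (∀ v, γ t ≠ G.vertexPoint v) →
      Metric.infEDist (γ t) S ≤ ENNReal.ofReal ((N : ℝ) / 4) := by
    intro t ht htv
    rcases eq_vertexPoint_or_edgePoint (γ t) with ⟨w, hw⟩ | ⟨u, v, e, τ, hτ, hp⟩
    · exact absurd hw (htv w)
    rcases h u v e with hs | ⟨n, hn, C, i, hi⟩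
    · rw [Metric.infEDist_zero_of_mem (hs.mem_of_isPreconnected e hτ hγ hS hx hy ht hp)]
      exact bot_le
    · refine (C.infEDist_le ?_ htv hγ hS hx hy ht rfl).trans ?_
      · rw [hp]
        rcases Sym2.eq_iff.1 hi with ⟨rfl, rfl⟩ | ⟨rfl, rfl⟩
        · exact C.edgePoint_mem_range_loop _
        · rw [edgePoint_symm]
          exact C.edgePoint_mem_range_loop _
      · apply ENNReal.ofReal_le_ofReal
        have : (n : ℝ) ≤ N := by exact_mod_cast hn
        linarith
  by_cases hv : ∃ v, γ t₀ = G.vertexPoint v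
  swap
  · push Not at hv
    exact main t₀ ht₀ hv
  obtain ⟨v, hv⟩ := hv
  rcases hL.eq_or_lt with rfl | hL
  · have : t₀ = 0 := le_antisymm ht₀.2 ht₀.1
    rw [this, Metric.infEDist_zero_of_mem hx]
    exact bot_le
  -- A vertex is approximated by points of the geodesic at distance less than `1`, which are not
  -- vertices because different vertices are at least `1` apart.
  refine ENNReal.le_of_forall_pos_le_add fun ε hε _ => ?_
  obtain ⟨t, ht, hne, hlt1, hlt2⟩ : ∃ t ∈ Set.Icc 0 L, t ≠ t₀ ∧ |t₀ - t| < 1 ∧ |t₀ - t| ≤ ε := by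
    obtain ⟨r, hr0, hr⟩ := exists_between (lt_min (lt_min one_pos (NNReal.coe_pos.2 hε))
      (half_pos hL))
    simp only [lt_min_iff] at hr
    obtain ⟨⟨hr1, hr2⟩, hr3⟩ := hr
    rcases le_or_gt t₀ (L / 2) with hc | hc
    · refine ⟨t₀ + r, ⟨by linarith [ht₀.1], by linarith⟩, by linarith, ?_, ?_⟩ <;>
        rw [abs_sub_comm, add_sub_cancel_left, abs_of_pos hr0]
      · exact hr1
      · exact hr2.le
    · refine ⟨t₀ - r, ⟨by linarith, by linarith [ht₀.2]⟩, by linarith, ?_, ?_⟩ <;>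
        rw [sub_sub_cancel, abs_of_pos hr0]
      · exact hr1
      · exact hr2.le
  have htv : ∀ w, γ t ≠ G.vertexPoint w := by
    intro w hw
    have hvw : v ≠ w := by
      rintro rfl
      exact hne (injOn_of_edist_eq hγ ht ht₀ (hw.trans hv.symm))
    have h1 := one_le_edist_vertexPoint (G := G) hvw
    rw [← hv, ← hw, hγ _ ht₀ _ ht, ENNReal.one_le_ofReal] at h1
    linarith
  refine (Metric.infEDist_le_infEDist_add_edist (y := γ t)).trans (add_le_add (main t ht htv) ?_)
  rw [hγ _ ht₀ _ ht]
  exact ENNReal.ofReal_le_of_le_toReal hlt2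

end UpperBound


/-! ### Cycles are gated and all other edges are bridges. -/

section Gates

variable {V : Type*} {G : SimpleGraph V}

lemma IsCycleSubgraph.exists_vert {C : G.Subgraph} (hC : G.IsCycleSubgraph C) :
    ∃ (n : ℕ) (vert : ZMod n → V), 3 ≤ n ∧ Function.Injective vert ∧
      (∀ i, G.Adj (vert i) (vert (i + 1))) ∧
      (∀ e, e ∈ C.edgeSet ↔ ∃ i, e = s(vert i, vert (i + 1))) ∧ C.edgeSet.encard = n := by
  classical
  obtain ⟨u, p, hp, rfl⟩ := hC
  have h3 := hp.three_le_length
  have : NeZero p.length := ⟨by omega⟩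
  -- The index wraps around at the last vertex, where the closed walk is back at its start.
  have hsucc : ∀ i : ZMod p.length, p.getVert (i + 1).val = p.getVert (i.val + 1) := by
    intro i
    have hlt := ZMod.val_lt i
    have h1 : (1 : ZMod p.length).val = 1 := ZMod.val_one'' (by omega)
    rcases Nat.lt_or_ge (i.val + 1) p.length with h | h
    · rw [ZMod.val_add_of_lt (by rw [h1]; exact h), h1]
    · have h2 : i.val + 1 = p.length := by omega
      have h4 : i + 1 = 0 := by
        rw [← ZMod.natCast_zmod_val i, ← Nat.cast_succ, Nat.succ_eq_add_one, h2]
        exact ZMod.natCast_self _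
      rw [h4, h2, ZMod.val_zero, Walk.getVert_zero, Walk.getVert_length]
  refine ⟨p.length, fun i => p.getVert i.val, h3, ?_, ?_, ?_, ?_⟩
  · intro i j hij
    apply ZMod.val_injective
    refine hp.getVert_injOn' ?_ ?_ hij <;> simp only [Set.mem_ofPred_eq]
    · have := ZMod.val_lt i; omega
    · have := ZMod.val_lt j; omega
  · intro i
    simp only [hsucc]
    exact p.adj_getVert_succ (ZMod.val_lt i)
  · intro e
    simp only [hsucc, Walk.mem_edges_toSubgraph]
    induction e with
    | h a b =>
      rw [Walk.mk_mem_edges_iff_exists]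
      constructor
      · rintro ⟨i, hi, h⟩
        refine ⟨(i : ZMod p.length), ?_⟩
        rw [ZMod.val_cast_of_lt hi, h]
      · rintro ⟨i, hi⟩
        exact ⟨i.val, ZMod.val_lt i, hi.symm⟩
  · have : p.toSubgraph.edgeSet = (p.edges.toFinset : Set (Sym2 V)) := by
      ext e
      simp
    rw [this, Set.encard_coe_eq_coe_finsetCard, List.toFinset_card_of_nodup hp.edges_nodup,
      Walk.length_edges]

lemma succ_ne_pred {n : ℕ} (hn : 3 ≤ n) (i : ZMod n) : i + 1 ≠ i - 1 := by
  intro h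
  have h2 : ((2 : ℕ) : ZMod n) = 0 := by
    push_cast
    linear_combination h
  have := Nat.le_of_dvd (by norm_num) ((ZMod.natCast_eq_zero_iff 2 n).1 h2)
  omega

/-- Matching the two edges in reverse would give `j + 1 = j - 1`, impossible for `3 ≤ n`. -/
lemma eq_of_cycle_edge_eq {n : ℕ} (hn : 3 ≤ n) {vert : ZMod n → V}
    (hinj : Function.Injective vert) {i j : ZMod n}
    (h : s(vert i, vert (i + 1)) = s(vert j, vert (j + 1))) : i = j := by
  rcases Sym2.eq_iff.1 h with ⟨h1, -⟩ | ⟨h1, h2⟩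
  · exact hinj h1
  · have h1 := hinj h1
    have h2 := hinj h2
    exact absurd (show j + 1 = j - 1 by rw [← h1, ← h2]; ring) (succ_ne_pred hn j)

/-- After removal of the edges of a cycle, different vertices of the cycle are in different
components, provided that no edge lies on two cycles. -/
lemma HasProperCycles.eq_of_reachable (hG : G.HasProperCycles) {C : G.Subgraph}
    (hC : G.IsCycleSubgraph C) {n : ℕ} {vert : ZMod n → V} (hn : 3 ≤ n)
    (hinj : Function.Injective vert) (hadj : ∀ i, G.Adj (vert i) (vert (i + 1)))
    (hedge : ∀ e, e ∈ C.edgeSet ↔ ∃ i, e = s(vert i, vert (i + 1))) {i j : ZMod n}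
    (hr : (G.deleteEdges C.edgeSet).Reachable (vert i) (vert j)) : i = j := by
  by_contra hij
  have : NeZero n := ⟨by omega⟩
  -- `e` and `f` are the two edges of the cycle at `vert j`. The aim is a cycle through `e` that
  -- avoids `f`, hence a second cycle through `e`.
  set e := s(vert (j - 1), vert (j - 1 + 1)) with he
  set f := s(vert j, vert (j + 1)) with hf
  have heC : e ∈ C.edgeSet := (hedge _).2 ⟨_, rfl⟩
  have hfC : f ∈ C.edgeSet := (hedge _).2 ⟨_, rfl⟩
  have hef : e ≠ f := by
    intro h
    have h1 := eq_of_cycle_edge_eq hn hinj h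
    have h2 := hadj j
    rw [show j + 1 = j by linear_combination -h1] at h2
    exact h2.ne rfl
  set K := (G.deleteEdges {f}).deleteEdges {e} with hK
  have hHK : G.deleteEdges C.edgeSet ≤ K := by
    intro a b hab
    simp only [hK, deleteEdges_adj, Set.mem_singleton_iff] at hab ⊢
    exact ⟨⟨hab.1, fun h => hab.2 (h ▸ hfC)⟩, fun h => hab.2 (h ▸ heC)⟩
  have hcast : ∀ k : ℕ, 0 < k → k < n → (k : ZMod n) ≠ 0 := by
    intro k h0 h1 h
    exact absurd (Nat.le_of_dvd h0 ((ZMod.natCast_eq_zero_iff k n).1 h)) (by omega)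
  -- The arc from `vert (j + 1)` to `vert (j - 1)` that avoids `vert j` uses neither `e` nor `f`,
  -- and it contains `vert i`.
  have harc : ∀ k : ℕ, k + 2 ≤ n → K.Reachable (vert (j + 1)) (vert (j + 1 + k)) := by
    intro k
    induction k with
    | zero => intro _; simp
    | succ k ih =>
      intro hk
      refine (ih (by omega)).trans (Adj.reachable ?_)
      simp only [hK, deleteEdges_adj, Set.mem_singleton_iff, Nat.cast_succ, ← add_assoc]
      refine ⟨⟨hadj _, fun h => ?_⟩, fun h => ?_⟩
      · have := eq_of_cycle_edge_eq hn hinj h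
        apply hcast (k + 1) (by omega) (by omega)
        push_cast
        linear_combination this
      · have := eq_of_cycle_edge_eq hn hinj h
        apply hcast (k + 2) (by omega) (by omega)
        push_cast
        linear_combination this
  have hlast : j + 1 + ((n - 2 : ℕ) : ZMod n) = j - 1 := by
    rw [Nat.cast_sub (by omega), ZMod.natCast_self]
    push_cast
    ring
  have h1 := harc (n - 2) (by omega)
  rw [hlast] at h1
  obtain ⟨k, hk, hki⟩ : ∃ k : ℕ, k + 2 ≤ n ∧ j + 1 + (k : ZMod n) = i := by
    refine ⟨(i - (j + 1)).val, ?_, by rw [ZMod.natCast_zmod_val]; ring⟩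
    by_contra hc
    have hlt := ZMod.val_lt (i - (j + 1))
    have h2 : (i - (j + 1)).val + 1 = n := by omega
    have h3 : (((i - (j + 1)).val + 1 : ℕ) : ZMod n) = 0 := by rw [h2, ZMod.natCast_self]
    rw [Nat.cast_succ, ZMod.natCast_zmod_val] at h3
    exact hij (by linear_combination h3)
  have h2 := harc k hk
  rw [hki] at h2
  -- Follow the arc from `vert (j - 1)` to `vert i`, then the connection from `vert i` to `vert j`
  -- off the cycle. So `e` is not a bridge after the removal of `f`.
  have hreach : K.Reachable (vert (j - 1)) (vert (j - 1 + 1)) := by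
    rw [sub_add_cancel]
    exact h1.symm.trans (h2.trans (hr.mono hHK))
  have hnb : ¬ (G.deleteEdges {f}).IsBridge e := by
    rw [he, isBridge_iff]
    exact not_not.2 hreach
  rw [isBridge_iff_forall_cycle_notMem (by
    rw [edgeSet_deleteEdges]
    exact ⟨C.edgeSet_subset heC, hef⟩)] at hnb
  push Not at hnb
  obtain ⟨u, p, hp, hep⟩ := hnb
  have hle : G.deleteEdges {f} ≤ G := deleteEdges_le _
  have hCD := hG e (C.edgeSet_subset heC) C (p.mapLe hle).toSubgraph hC
    ⟨u, p.mapLe hle, hp.mapLe hle, rfl⟩ heC (by simpa using hep)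
  rw [hCD, Walk.mem_edges_toSubgraph, Walk.edges_mapLe_eq_edges] at hfC
  have := p.edges_subset_edgeSet hfC
  rw [edgeSet_deleteEdges] at this
  exact this.2 rfl

/-- In a connected graph without edges that lie on two cycles, every cycle is gated. -/
theorem HasProperCycles.exists_gatedCycle (hconn : G.Connected) (hG : G.HasProperCycles)
    {C : G.Subgraph} (hC : G.IsCycleSubgraph C) :
    ∃ (n : ℕ) (D : GatedCycle G n), C.edgeSet.encard = n ∧
      ∀ e, e ∈ C.edgeSet ↔ ∃ i, e = s(D.vert i, D.vert (i + 1)) := by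
  obtain ⟨n, vert, hn, hinj, hadj, hedge, hcard⟩ := hC.exists_vert
  have huniq : ∀ {i j}, (G.deleteEdges C.edgeSet).Reachable (vert i) (vert j) → i = j :=
    fun hr => hG.eq_of_reachable hC hn hinj hadj hedge hr
  -- Walk from `v` towards `vert 0` and stop at the first edge of the cycle, whose ends are vertices
  -- of the cycle.
  have hex : ∀ v, ∃ i, (G.deleteEdges C.edgeSet).Reachable v (vert i) := by
    have key : ∀ {v u : V}, G.Walk v u → (∃ i, (G.deleteEdges C.edgeSet).Reachable u (vert i)) →
        ∃ i, (G.deleteEdges C.edgeSet).Reachable v (vert i) := by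
      intro v u p
      induction p with
      | nil => exact id
      | @cons a b c hab p ih =>
        intro h
        by_cases he : s(a, b) ∈ C.edgeSet
        · obtain ⟨i, hi⟩ := (hedge _).1 he
          rcases Sym2.eq_iff.1 hi with ⟨rfl, -⟩ | ⟨rfl, -⟩
          · exact ⟨_, Reachable.refl _⟩
          · exact ⟨_, Reachable.refl _⟩
        · obtain ⟨i, hi⟩ := ih h
          refine ⟨i, Reachable.trans (Adj.reachable ?_) hi⟩
          rw [deleteEdges_adj]
          exact ⟨hab, he⟩
    intro v
    obtain ⟨p⟩ := hconn.preconnected v (vert 0)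
    exact key p ⟨0, Reachable.refl _⟩
  choose gate hgate using hex
  have hgv : ∀ i, gate (vert i) = i := fun i => (huniq (hgate (vert i))).symm
  refine ⟨n, ⟨vert, gate, hn, hgv, hadj, fun a b hab => ?_⟩, hcard, hedge⟩
  by_cases he : s(a, b) ∈ C.edgeSet
  · right
    obtain ⟨i, hi⟩ := (hedge _).1 he
    rcases Sym2.eq_iff.1 hi with ⟨rfl, rfl⟩ | ⟨rfl, rfl⟩ <;> simp [hgv]
  · left
    have hab' : (G.deleteEdges C.edgeSet).Adj a b := by
      rw [deleteEdges_adj]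
      exact ⟨hab, he⟩
    exact huniq ((hgate a).symm.trans (hab'.reachable.trans (hgate b)))

/-- Such an edge is a bridge, and its removal leaves the component of `u`, on which the separating
function is `0`. -/
lemma isSplit_of_notMem_cycle {u v : V} (huv : G.Adj u v)
    (h : ∀ C, G.IsCycleSubgraph C → s(u, v) ∉ C.edgeSet) : G.IsSplit u v := by
  classical
  have hb : G.IsBridge s(u, v) := by
    rw [isBridge_iff_forall_cycle_notMem (by simpa using huv)]
    intro w p hp hmem
    exact h _ ⟨w, p, hp, rfl⟩ (p.mem_edges_toSubgraph.2 hmem)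
  rw [isBridge_iff] at hb
  refine ⟨fun a => if (G.deleteEdges {s(u, v)}).Reachable u a then 0 else 1, fun a => ?_, ?_, ?_,
    fun a b hab hne => ?_⟩
  · by_cases h : (G.deleteEdges {s(u, v)}).Reachable u a <;> simp [h]
  · simp
  · simp [hb]
  · by_contra hc
    have hab' : (G.deleteEdges {s(u, v)}).Adj a b := by
      rw [deleteEdges_adj]
      exact ⟨hab, hc⟩
    apply hne
    have : (G.deleteEdges {s(u, v)}).Reachable u a ↔ (G.deleteEdges {s(u, v)}).Reachable u b :=
      ⟨fun h => h.trans hab'.reachable, fun h => h.trans hab'.symm.reachable⟩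
    simp only [this]

end Gates


/-! ### Bridges and gated cycles under contraction of an edge. -/

section Contraction

variable {V : Type*} {G : SimpleGraph V} {e : Sym2 V}

lemma contract_mk_eq_iff {a b : V} :
    (Quotient.mk (contractSetoid e) a = Quotient.mk (contractSetoid e) b) ↔
      a = b ∨ (a ∈ e ∧ b ∈ e) := Quotient.eq

lemma contract_adj_iff {x y : Quotient (contractSetoid e)} : (G.contract e).Adj x y ↔
    x ≠ y ∧ ∃ a b, G.Adj a b ∧ Quotient.mk (contractSetoid e) a = x ∧
      Quotient.mk (contractSetoid e) b = y := Iff.rfl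

lemma eq_mk_of_mem {a b : V} (ha : a ∈ e) (hb : b ∈ e) (hab : a ≠ b) : e = s(a, b) :=
  (Sym2.mem_and_mem_iff hab).1 ⟨ha, hb⟩

lemma IsSplit.symm {u v : V} (h : G.IsSplit u v) : G.IsSplit v u := by
  obtain ⟨h, h01, hu, hv, hab⟩ := h
  refine ⟨fun a => 1 - h a, fun a => ?_, by simp [hv], by simp [hu], fun a b e hne => ?_⟩
  · rcases h01 a with ha | ha <;> simp [ha]
  · rw [Sym2.eq_swap (a := v), hab a b e fun hc => hne (by simp [hc])]

/-- The separating function changes only across `s(u, v)`, so it agrees at the ends of `e` and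
descends to the quotient. -/
lemma IsSplit.contract {u v : V} (h : G.IsSplit u v) (he : e ∈ G.edgeSet) (hne : e ≠ s(u, v)) :
    (G.contract e).IsSplit (Quotient.mk (contractSetoid e) u)
      (Quotient.mk (contractSetoid e) v) := by
  obtain ⟨h, h01, hu, hv, hab⟩ := h
  have hresp : ∀ a b : V, (contractSetoid e).r a b → h a = h b := by
    rintro a b (rfl | ⟨ha, hb⟩)
    · rfl
    by_contra hc
    have hab' : a ≠ b := fun hab' => hc (by rw [hab'])
    have h1 := eq_mk_of_mem ha hb hab'
    rw [h1, mem_edgeSet] at he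
    exact hne (h1.trans (hab a b he hc))
  refine ⟨Quotient.lift h hresp, fun a => ?_, hu, hv, fun x y hxy hc => ?_⟩
  · induction a using Quotient.inductionOn with
    | h a => exact h01 a
  · obtain ⟨-, a, b, hadj, rfl, rfl⟩ := hxy
    have := congrArg (Sym2.map (Quotient.mk (contractSetoid e))) (hab a b hadj hc)
    simpa using this

namespace GatedCycle

variable {n : ℕ}

/-- A gated cycle survives the contraction of an edge outside of it. -/
def contract (D : GatedCycle G n) (he : e ∈ G.edgeSet)
    (hD : ∀ i, e ≠ s(D.vert i, D.vert (i + 1))) : GatedCycle (G.contract e) n where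
  vert i := Quotient.mk (contractSetoid e) (D.vert i)
  gate := Quotient.lift D.gate (by
    rintro a b (rfl | ⟨ha, hb⟩)
    · rfl
    by_contra hc
    have hab : a ≠ b := fun hab => hc (by rw [hab])
    have h1 := eq_mk_of_mem ha hb hab
    rw [h1, mem_edgeSet] at he
    rcases D.gate_eq_or a b he with h | ⟨h2, h3, h | h⟩
    · exact hc h
    · apply hD (D.gate a)
      rw [h1, ← h, ← h2, ← h3]
    · apply hD (D.gate b)
      rw [h1, ← h, ← h2, ← h3, Sym2.eq_swap])
  three_le := D.three_le
  gate_vert i := D.gate_vert i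
  adj_vert i := by
    refine contract_adj_iff.2 ⟨fun h => ?_, _, _, D.adj_vert i, rfl, rfl⟩
    have hne := (D.adj_vert i).ne
    rcases contract_mk_eq_iff.1 h with h | ⟨h1, h2⟩
    · exact hne h
    · exact hD i (eq_mk_of_mem h1 h2 hne)
  gate_eq_or x y hxy := by
    obtain ⟨-, a, b, hab, rfl, rfl⟩ := hxy
    rcases D.gate_eq_or a b hab with h | ⟨h2, h3, h⟩
    · exact Or.inl h
    · exact Or.inr ⟨congrArg _ h2, congrArg _ h3, h⟩

/-- The same cycle with another starting point. -/
def rotate (D : GatedCycle G n) (k : ZMod n) : GatedCycle G n where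
  vert i := D.vert (i + k)
  gate v := D.gate v - k
  three_le := D.three_le
  gate_vert i := by rw [D.gate_vert, add_sub_cancel_right]
  adj_vert i := by
    rw [add_right_comm]
    exact D.adj_vert (i + k)
  gate_eq_or a b hab := by
    simp only [sub_add_cancel, sub_left_inj]
    refine (D.gate_eq_or a b hab).imp_right fun ⟨h1, h2, h3⟩ => ⟨h1, h2, h3.imp ?_ ?_⟩ <;>
      rintro h <;> rw [h] <;> ring

variable {m : ℕ}

lemma val_eq_of_mem (D : GatedCycle G (m + 1)) (he : e = s(D.vert (-1), D.vert 0)) {a : V}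
    (ha : a ∈ e) : a = D.vert (-1) ∧ (D.gate a).val = m ∨ a = D.vert 0 ∧ (D.gate a).val = 0 := by
  rw [he, Sym2.mem_iff] at ha
  rcases ha with rfl | rfl
  · exact Or.inl ⟨rfl, by rw [D.gate_vert, ZMod.val_neg_one]⟩
  · exact Or.inr ⟨rfl, by rw [D.gate_vert, ZMod.val_zero]⟩

/-- Reducing the index modulo `m` matters only at `k = m`, which becomes `0`; these two vertices are
the ends of `e` and are merged. -/
lemma mk_vert_val (D : GatedCycle G (m + 1)) (hm : 0 < m) (he : e = s(D.vert (-1), D.vert 0))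
    {k : ℕ} (hk : k ≤ m) :
    Quotient.mk (contractSetoid e) (D.vert (((k : ZMod m).val : ℕ) : ZMod (m + 1))) =
      Quotient.mk (contractSetoid e) (D.vert (k : ZMod (m + 1))) := by
  rcases hk.eq_or_lt with rfl | hk
  · rw [ZMod.natCast_self, ZMod.val_zero, Nat.cast_zero, contract_mk_eq_iff]
    right
    rw [he, show (k : ZMod (k + 1)) = -1 by
      rw [eq_neg_iff_add_eq_zero]; exact_mod_cast ZMod.natCast_self (k + 1)]
    simp
  · rw [ZMod.val_cast_of_lt hk]

/-- The contraction of an edge of a cycle of length at least `4` shortens the cycle by one. -/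
def shrink (D : GatedCycle G (m + 1)) (hm : 3 ≤ m) (he : e = s(D.vert (-1), D.vert 0)) :
    GatedCycle (G.contract e) m where
  vert i := Quotient.mk (contractSetoid e) (D.vert (i.val : ZMod (m + 1)))
  gate := Quotient.lift (fun v => ((D.gate v).val : ZMod m)) (by
    have key : ∀ a ∈ e, ((D.gate a).val : ZMod m) = 0 := by
      intro a ha
      rcases D.val_eq_of_mem he ha with ⟨-, h⟩ | ⟨-, h⟩ <;> simp [h]
    rintro a b (rfl | ⟨ha, hb⟩)
    · rfl
    · exact (key a ha).trans (key b hb).symm)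
  three_le := hm
  gate_vert i := by
    have : NeZero m := ⟨by omega⟩
    simp only [Quotient.lift_mk, D.gate_vert]
    rw [ZMod.val_cast_of_lt ((ZMod.val_lt i).trans (Nat.lt_succ_self m)), ZMod.natCast_zmod_val]
  adj_vert i := by
    have : NeZero m := ⟨by omega⟩
    have hlt := ZMod.val_lt i
    have h1 : i + 1 = ((i.val + 1 : ℕ) : ZMod m) := by
      rw [Nat.cast_succ, ZMod.natCast_zmod_val]
    rw [h1, D.mk_vert_val (by omega) he hlt]
    refine contract_adj_iff.2 ⟨fun h => ?_, _, _, by exact_mod_cast D.adj_vert (i.val), rfl, rfl⟩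
    rcases contract_mk_eq_iff.1 h with h | ⟨h1, h2⟩
    · refine (D.adj_vert (i.val)).ne ?_
      exact_mod_cast h
    · have h3 := D.val_eq_of_mem he h1
      have h4 := D.val_eq_of_mem he h2
      rw [D.gate_vert, ZMod.val_cast_of_lt (by omega)] at h3 h4
      omega
  gate_eq_or x y hxy := by
    obtain ⟨-, a, b, hab, rfl, rfl⟩ := hxy
    simp only [Quotient.lift_mk]
    have key : ∀ a b : V, a = D.vert (D.gate a) → b = D.vert (D.gate b) →
        D.gate b = D.gate a + 1 → ((D.gate a).val : ZMod m) = ((D.gate b).val : ZMod m) ∨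
        (Quotient.mk (contractSetoid e) a = Quotient.mk (contractSetoid e)
          (D.vert ((((D.gate a).val : ZMod m).val : ℕ) : ZMod (m + 1))) ∧
        Quotient.mk (contractSetoid e) b = Quotient.mk (contractSetoid e)
          (D.vert ((((D.gate b).val : ZMod m).val : ℕ) : ZMod (m + 1))) ∧
        ((D.gate b).val : ZMod m) = ((D.gate a).val : ZMod m) + 1) := by
      intro a b ha hb hab
      have hlt := ZMod.val_lt (D.gate a)
      have h1 : (1 : ZMod (m + 1)).val = 1 := ZMod.val_one'' (by omega)
      -- The step from index `m` back to `0` runs along `e` and collapses; every other step remains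
      -- a step of the shorter cycle.
      rcases (Nat.lt_succ_iff.1 hlt).eq_or_lt with h | h
      · left
        have h0 : D.gate b = 0 := by
          rw [hab, ← ZMod.natCast_zmod_val (D.gate a), h]
          exact_mod_cast ZMod.natCast_self (m + 1)
        rw [h, h0, ZMod.val_zero, ZMod.natCast_self, Nat.cast_zero]
      · right
        have hb' : (D.gate b).val = (D.gate a).val + 1 := by
          rw [hab, ZMod.val_add_of_lt (by rw [h1]; omega), h1]
        refine ⟨?_, ?_, ?_⟩
        · rw [D.mk_vert_val (by omega) he h.le, ZMod.natCast_zmod_val, ← ha]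
        · rw [D.mk_vert_val (by omega) he (by omega), ZMod.natCast_zmod_val, ← hb]
        · rw [hb', Nat.cast_succ]
    rcases D.gate_eq_or a b hab with h | ⟨ha, hb, h | h⟩
    · exact Or.inl (by rw [h])
    · exact (key a b ha hb h).imp_right fun ⟨h1, h2, h3⟩ => ⟨h1, h2, Or.inl h3⟩
    · rcases key b a hb ha h with h | ⟨h1, h2, h3⟩
      · exact Or.inl h.symm
      · exact Or.inr ⟨h2, h1, Or.inr h3⟩

/-- The contraction of an edge of a triangle makes the two other edges one separating edge. -/
lemma isSplit_contract_triangle (D : GatedCycle G 3) (he : e = s(D.vert (-1), D.vert 0)) :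
    (G.contract e).IsSplit (Quotient.mk (contractSetoid e) (D.vert 0))
      (Quotient.mk (contractSetoid e) (D.vert 1)) := by
  have hgate : ∀ a ∈ e, D.gate a ≠ 1 := by
    intro a ha
    rw [he, Sym2.mem_iff] at ha
    rcases ha with rfl | rfl <;> rw [D.gate_vert] <;> decide
  have hmk : ∀ a, a = D.vert (D.gate a) → D.gate a ≠ 1 →
      Quotient.mk (contractSetoid e) a = Quotient.mk (contractSetoid e) (D.vert 0) := by
    intro a ha h1
    refine contract_mk_eq_iff.2 (Or.inr ⟨?_, by simp [he]⟩)
    have h3 : ∀ i : ZMod 3, i ≠ 1 → i = -1 ∨ i = 0 := by decide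
    rw [he, Sym2.mem_iff]
    exact (h3 _ h1).imp (fun h => by rw [ha, h]) (fun h => by rw [ha, h])
  refine ⟨Quotient.lift (fun v => if D.gate v = 1 then 1 else 0) ?_, fun x => ?_, ?_, ?_,
    fun x y hxy hne => ?_⟩
  · rintro a b (rfl | ⟨ha, hb⟩)
    · rfl
    · rw [if_neg (hgate a ha), if_neg (hgate b hb)]
  · induction x using Quotient.inductionOn with
    | h a =>
      simp only [Quotient.lift_mk]
      by_cases h : D.gate a = 1 <;> simp [h]
  · simp [D.gate_vert]
  · simp [D.gate_vert]
  · obtain ⟨-, a, b, hab, rfl, rfl⟩ := hxy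
    simp only [Quotient.lift_mk] at hne
    rcases D.gate_eq_or a b hab with h | ⟨ha, hb, -⟩
    · exact absurd (by rw [h]) hne
    · by_cases h1 : D.gate a = 1 <;> by_cases h2 : D.gate b = 1
      · simp [h1, h2] at hne
      · rw [hmk b hb h2, ha, h1, Sym2.eq_swap]
      · rw [hmk a ha h1, hb, h2]
      · simp [h1, h2] at hne

end GatedCycle

lemma mk_ne_mk_of_sym2_eq {u v u' v' : V} (h : s(u, v) = s(u', v'))
    (hne : Quotient.mk (contractSetoid e) u ≠ Quotient.mk (contractSetoid e) v) :
    e ≠ s(u', v') := by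
  rintro rfl
  rw [← h] at hne
  exact hne (contract_mk_eq_iff.2 (Or.inr ⟨Sym2.mem_mk_left _ _, Sym2.mem_mk_right _ _⟩))

/-- If every edge of `G` is separating or lies on a gated cycle whose length is at most `N`, or
`N + 1` if the cycle contains `e`, then the contraction of `e` gives an `N / 4`-hyperbolic
graph. -/
theorem hyperbolicityConstant_contract_le {N : ℕ} (he : e ∈ G.edgeSet)
    (h : ∀ u v, G.Adj u v → G.IsSplit u v ∨
      ∃ (n : ℕ) (D : GatedCycle G n) (i : ZMod n), s(u, v) = s(D.vert i, D.vert (i + 1)) ∧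
        (n ≤ N ∨ n ≤ N + 1 ∧ ∃ j, e = s(D.vert j, D.vert (j + 1)))) :
    hyperbolicityConstant (G.contract e).MetricGraph ≤ (N : ℝ≥0∞) / 4 := by
  apply hyperbolicityConstant_le_of_isSplit_or
  rintro x y ⟨hxy, u, v, huv, rfl, rfl⟩
  have hne := mk_ne_mk_of_sym2_eq rfl hxy
  rcases h u v huv with hs | ⟨n, D, i, hi, hn⟩
  · exact Or.inl (hs.contract he hne)
  have hmap := congrArg (Sym2.map (Quotient.mk (contractSetoid e))) hi
  simp only [Sym2.map_mk] at hmap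
  by_cases hj : ∃ j, e = s(D.vert j, D.vert (j + 1))
  swap
  · right
    have hn' : n ≤ N := hn.resolve_right fun h => hj h.2
    push Not at hj
    exact ⟨n, hn', D.contract he hj, i, hmap⟩
  obtain ⟨j, hj⟩ := hj
  have h3 := D.three_le
  obtain ⟨m, rfl⟩ : ∃ m, n = m + 1 := ⟨n - 1, by omega⟩
  have hm : m ≤ N := by omega
  -- Rotate the cycle so that `e` is its closing edge, from index `-1` to `0`.
  obtain ⟨D, i, hi, hj⟩ : ∃ (D : GatedCycle G (m + 1)) (i : ZMod (m + 1)),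
      s(u, v) = s(D.vert i, D.vert (i + 1)) ∧ e = s(D.vert (-1), D.vert 0) := by
    refine ⟨D.rotate (j + 1), i - (j + 1), ?_, ?_⟩
    · simp only [GatedCycle.rotate]
      rw [hi]
      ring_nf
    · simp only [GatedCycle.rotate]
      rw [hj]
      ring_nf
  have hmap := congrArg (Sym2.map (Quotient.mk (contractSetoid e))) hi
  simp only [Sym2.map_mk] at hmap
  have hi1 : i ≠ -1 := by
    rintro rfl
    rw [neg_add_cancel] at hi
    exact hne (hj.trans hi.symm)
  -- A triangle would shrink to length `2`, which is no cycle: its two remaining edges become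
  -- parallel and are identified to one separating edge.
  rcases (show m = 2 ∨ 3 ≤ m by omega) with rfl | hm3
  · left
    have hs := D.isSplit_contract_triangle hj
    have hi' : i = 0 ∨ i = 1 := by
      have h3 : ∀ i : ZMod (2 + 1), i ≠ -1 → i = 0 ∨ i = 1 := by decide
      exact h3 i hi1
    have hmk : Quotient.mk (contractSetoid e) (D.vert (1 + 1)) =
        Quotient.mk (contractSetoid e) (D.vert 0) := by
      rw [show (1 + 1 : ZMod (2 + 1)) = -1 by decide]
      exact contract_mk_eq_iff.2 (Or.inr (by simp [hj]))
    have hmap' : s(Quotient.mk (contractSetoid e) u, Quotient.mk (contractSetoid e) v) =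
        s(Quotient.mk (contractSetoid e) (D.vert 0),
          Quotient.mk (contractSetoid e) (D.vert 1)) := by
      rcases hi' with rfl | rfl
      · rwa [zero_add] at hmap
      · rwa [hmk, Sym2.eq_swap (a := Quotient.mk (contractSetoid e) (D.vert 1))] at hmap
    rcases Sym2.eq_iff.1 hmap' with ⟨h1, h2⟩ | ⟨h1, h2⟩
    · rw [h1, h2]
      exact hs
    · rw [h1, h2]
      exact hs.symm
  · right
    refine ⟨m, hm, D.shrink hm3 hj, (i.val : ℕ), ?_⟩
    have hlt : i.val < m := by
      refine lt_of_le_of_ne (Nat.lt_succ_iff.1 (ZMod.val_lt i)) fun h => hi1 ?_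
      rw [← ZMod.natCast_zmod_val i, h, eq_neg_iff_add_eq_zero]
      exact_mod_cast ZMod.natCast_self (m + 1)
    have e1 := D.mk_vert_val (by omega) hj hlt.le
    have e2 := D.mk_vert_val (by omega) hj (Nat.succ_le_of_lt hlt)
    rw [ZMod.natCast_zmod_val] at e1
    rw [Nat.succ_eq_add_one, Nat.cast_succ, Nat.cast_succ, ZMod.natCast_zmod_val] at e2
    rw [hmap]
    exact congrArg₂ (fun a b => s(a, b)) e1.symm e2.symm

end Contraction


/-! ### Comparison of the hyperbolicity constants with the circumference. -/

section Circumference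

variable {V : Type*} {G : SimpleGraph V} {e : Sym2 V}

lemma IsCycleSubgraph.encard_le_circumference {C : G.Subgraph} (hC : G.IsCycleSubgraph C) :
    C.edgeSet.encard ≤ G.circumference :=
  le_iSup₂_of_le C hC le_rfl

lemma HasProperCycles.isSplit_or_exists_gatedCycle (hconn : G.Connected) (hG : G.HasProperCycles)
    {u v : V} (huv : G.Adj u v) : G.IsSplit u v ∨
      ∃ C, G.IsCycleSubgraph C ∧ ∃ (n : ℕ) (D : GatedCycle G n) (i : ZMod n),
        s(u, v) = s(D.vert i, D.vert (i + 1)) ∧ C.edgeSet.encard = n ∧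
          ∀ e, e ∈ C.edgeSet ↔ ∃ i, e = s(D.vert i, D.vert (i + 1)) := by
  by_cases h : ∃ C, G.IsCycleSubgraph C ∧ s(u, v) ∈ C.edgeSet
  · right
    obtain ⟨C, hC, he⟩ := h
    obtain ⟨n, D, hn, hD⟩ := hG.exists_gatedCycle hconn hC
    obtain ⟨i, hi⟩ := (hD _).1 he
    exact ⟨C, hC, n, D, i, hi, hn, hD⟩
  · push Not at h
    exact Or.inl (isSplit_of_notMem_cycle huv h)

lemma HasProperCycles.hyperbolicityConstant_le (hconn : G.Connected) (hG : G.HasProperCycles)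
    {N : ℕ} (hN : G.circumference ≤ N) :
    hyperbolicityConstant G.MetricGraph ≤ (N : ℝ≥0∞) / 4 := by
  apply hyperbolicityConstant_le_of_isSplit_or
  intro u v huv
  refine (hG.isSplit_or_exists_gatedCycle hconn huv).imp_right ?_
  rintro ⟨C, hC, n, D, i, hi, hn, -⟩
  refine ⟨n, ?_, D, i, hi⟩
  have := hC.encard_le_circumference.trans hN
  rw [hn] at this
  exact_mod_cast this

lemma HasProperCycles.hyperbolicityConstant_contract_le (hconn : G.Connected)
    (hG : G.HasProperCycles) (he : e ∈ G.edgeSet) {N : ℕ}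
    (hN : ∀ C, G.IsCycleSubgraph C → e ∉ C.edgeSet → C.edgeSet.encard ≤ N)
    (hN' : ∀ C, G.IsCycleSubgraph C → e ∈ C.edgeSet → C.edgeSet.encard ≤ (N + 1 : ℕ)) :
    hyperbolicityConstant (G.contract e).MetricGraph ≤ (N : ℝ≥0∞) / 4 := by
  apply SimpleGraph.hyperbolicityConstant_contract_le he
  intro u v huv
  refine (hG.isSplit_or_exists_gatedCycle hconn huv).imp_right ?_
  rintro ⟨C, hC, n, D, i, hi, hn, hD⟩
  refine ⟨n, D, i, hi, ?_⟩
  by_cases heC : e ∈ C.edgeSet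
  · refine Or.inr ⟨?_, (hD e).1 heC⟩
    have := hN' C hC heC
    rw [hn] at this
    exact_mod_cast this
  · left
    have := hN C hC heC
    rw [hn] at this
    exact_mod_cast this

lemma HasProperCycles.le_hyperbolicityConstant (hconn : G.Connected) (hG : G.HasProperCycles)
    {C : G.Subgraph} (hC : G.IsCycleSubgraph C) :
    ((C.edgeSet.encard : ℕ∞) : ℝ≥0∞) / 4 ≤ hyperbolicityConstant G.MetricGraph := by
  obtain ⟨n, D, hn, -⟩ := hG.exists_gatedCycle hconn hC
  rw [hn]
  simpa using D.le_hyperbolicityConstant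

lemma HasProperCycles.le_hyperbolicityConstant_contract (hconn : G.Connected)
    (hG : G.HasProperCycles) (he : e ∈ G.edgeSet) {C : G.Subgraph} (hC : G.IsCycleSubgraph C)
    (heC : e ∉ C.edgeSet) :
    ((C.edgeSet.encard : ℕ∞) : ℝ≥0∞) / 4 ≤
      hyperbolicityConstant (G.contract e).MetricGraph := by
  obtain ⟨n, D, hn, hD⟩ := hG.exists_gatedCycle hconn hC
  rw [hn]
  rw [hD] at heC
  push Not at heC
  simpa using (D.contract he heC).le_hyperbolicityConstant

lemma IsCycleSubgraph.exists_encard_eq {C : G.Subgraph} (hC : G.IsCycleSubgraph C) :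
    ∃ n : ℕ, 3 ≤ n ∧ C.edgeSet.encard = n := by
  obtain ⟨n, -, h3, -, -, -, hn⟩ := hC.exists_vert
  exact ⟨n, h3, hn⟩

lemma eq_top_of_forall_exists_encard {P : G.Subgraph → Prop} {δ : ℝ≥0∞}
    (hP : ∀ N : ℕ, ∃ C, P C ∧ (N : ℕ∞) ≤ C.edgeSet.encard)
    (hδ : ∀ C, P C → ((C.edgeSet.encard : ℕ∞) : ℝ≥0∞) / 4 ≤ δ) : δ = ⊤ := by
  by_contra hne
  obtain ⟨N, hN⟩ := ENNReal.exists_nat_gt (ENNReal.mul_ne_top hne (by norm_num : (4 : ℝ≥0∞) ≠ ⊤))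
  obtain ⟨C, hC, hNC⟩ := hP N
  have h1 := hδ C hC
  rw [ENNReal.div_le_iff (by norm_num) (by norm_num)] at h1
  have h2 : (N : ℝ≥0∞) ≤ ((C.edgeSet.encard : ℕ∞) : ℝ≥0∞) := by exact_mod_cast hNC
  exact absurd (h2.trans h1) (not_le.2 hN)

lemma exists_encard_gt (htop : G.circumference = ⊤) (N : ℕ) :
    ∃ C, G.IsCycleSubgraph C ∧ (N : ℕ∞) < C.edgeSet.encard := by
  have : (N : ℕ∞) < G.circumference := by rw [htop]; exact ENat.natCast_lt_top N
  unfold circumference at this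
  simpa only [lt_iSup_iff, exists_prop] using this

lemma HasProperCycles.hyperbolicityConstant_eq_top (hconn : G.Connected) (hG : G.HasProperCycles)
    (htop : G.circumference = ⊤) : hyperbolicityConstant G.MetricGraph = ⊤ :=
  eq_top_of_forall_exists_encard (P := G.IsCycleSubgraph)
    (fun N => (exists_encard_gt htop N).imp fun _ h => ⟨h.1, h.2.le⟩)
    fun _ hC => hG.le_hyperbolicityConstant hconn hC

/-- At most one cycle contains `e`, and it is finite. Cycles longer than it avoid `e`, and they
survive the contraction at full length. -/
lemma HasProperCycles.hyperbolicityConstant_contract_eq_top (hconn : G.Connected)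
    (hG : G.HasProperCycles) (he : e ∈ G.edgeSet) (htop : G.circumference = ⊤) :
    hyperbolicityConstant (G.contract e).MetricGraph = ⊤ := by
  refine eq_top_of_forall_exists_encard (P := fun C => G.IsCycleSubgraph C ∧ e ∉ C.edgeSet)
    (fun N => ?_) fun C hC => hG.le_hyperbolicityConstant_contract hconn he hC.1 hC.2
  by_cases h : ∃ C, G.IsCycleSubgraph C ∧ e ∈ C.edgeSet
  · obtain ⟨C, hC, heC⟩ := h
    obtain ⟨m, -, hm⟩ := hC.exists_encard_eq
    obtain ⟨D, hD, hND⟩ := exists_encard_gt htop (max N m)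
    refine ⟨D, ⟨hD, fun heD => ?_⟩, le_trans (by exact_mod_cast le_max_left N m) hND.le⟩
    rw [← hG e he C D hC hD heC heD, hm] at hND
    exact absurd hND (not_lt.2 (by exact_mod_cast le_max_right N m))
  · push Not at h
    obtain ⟨D, hD, hND⟩ := exists_encard_gt htop N
    exact ⟨D, ⟨hD, h D hD⟩, hND.le⟩

/-- The contraction of an edge outside of some longest cycle does not change the hyperbolicity
constant. -/
lemma HasProperCycles.hyperbolicityConstant_contract_eq (hconn : G.Connected)
    (hG : G.HasProperCycles) (he : e ∈ G.edgeSet) {C : G.Subgraph} (hC : C ∈ G.longestCycles)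
    (heC : e ∉ C.edgeSet) :
    hyperbolicityConstant (G.contract e).MetricGraph = hyperbolicityConstant G.MetricGraph := by
  obtain ⟨n, -, hn⟩ := hC.1.exists_encard_eq
  have hcirc : G.circumference = n := hC.2.symm.trans hn
  have h1 := hG.le_hyperbolicityConstant hconn hC.1
  have h2 := hG.le_hyperbolicityConstant_contract hconn he hC.1 heC
  have h3 := hG.hyperbolicityConstant_le hconn hcirc.le
  have h4 := hG.hyperbolicityConstant_contract_le hconn he (N := n)
    (fun D hD _ => hD.encard_le_circumference.trans hcirc.le)
    (fun D hD _ => hD.encard_le_circumference.trans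
      (hcirc.le.trans (by exact_mod_cast n.le_succ)))
  rw [hn, ENat.toENNReal_coe] at h1 h2
  exact (le_antisymm h4 h2).trans (le_antisymm h3 h1).symm

/-- The contraction of an edge of the only longest cycle decreases the hyperbolicity constant. -/
lemma HasProperCycles.hyperbolicityConstant_contract_lt (hconn : G.Connected)
    (hG : G.HasProperCycles) (he : e ∈ G.edgeSet) {C : G.Subgraph} (hC : G.longestCycles = {C})
    (heC : e ∈ C.edgeSet) :
    hyperbolicityConstant (G.contract e).MetricGraph < hyperbolicityConstant G.MetricGraph := by
  have hCl : C ∈ G.longestCycles := hC ▸ rfl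
  obtain ⟨n, h3, hn⟩ := hCl.1.exists_encard_eq
  have hcirc : G.circumference = n := hCl.2.symm.trans hn
  obtain ⟨m, rfl⟩ : ∃ m, n = m + 1 := ⟨n - 1, by omega⟩
  have h1 := hG.le_hyperbolicityConstant hconn hCl.1
  -- The bound is `m = c - 1`: a cycle avoiding `e` is not `C`, hence is strictly shorter than `c`,
  -- while a cycle through `e` may have length `m + 1` because it loses one edge.
  have h2 := hG.hyperbolicityConstant_contract_le hconn he (N := m)
    (fun D hD heD => by
      obtain ⟨k, -, hk⟩ := hD.exists_encard_eq
      have hle := hD.encard_le_circumference.trans hcirc.le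
      have hne : D.edgeSet.encard ≠ G.circumference := by
        intro h
        have hDC : D ∈ G.longestCycles := ⟨hD, h⟩
        rw [hC, Set.mem_singleton_iff] at hDC
        exact heD (hDC ▸ heC)
      rw [hcirc, hk] at hne
      rw [hk] at hle ⊢
      norm_cast at hle hne ⊢
      omega)
    (fun D hD _ => hD.encard_le_circumference.trans hcirc.le)
  rw [hn, ENat.toENNReal_coe] at h1
  refine h2.trans_lt (lt_of_lt_of_le ?_ h1)
  exact ENNReal.div_lt_div_right (by norm_num) (by norm_num)
    (by exact_mod_cast m.lt_succ_self)

end Circumference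

end SimpleGraph

theorem theorem2p15 {V : Type*} (G : SimpleGraph V) (hconn : G.Connected)
    (hG : G.HasProperCycles) :
    ((G.circumference = ⊤ ∨ G.longestCycles.Nontrivial) →
      ∀ e ∈ G.edgeSet,
        hyperbolicityConstant (G.contract e).MetricGraph = hyperbolicityConstant G.MetricGraph) ∧
    (∀ C : G.Subgraph, G.longestCycles = {C} →
      ∀ e ∈ G.edgeSet,
        (hyperbolicityConstant (G.contract e).MetricGraph = hyperbolicityConstant G.MetricGraph ↔
          e ∉ C.edgeSet)) := by
  refine ⟨fun h e he => ?_, fun C hC e he => ⟨fun heq heC => ?_, fun heC => ?_⟩⟩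
  · rcases h with htop | ⟨C, hC, D, hD, hne⟩
    · rw [hG.hyperbolicityConstant_eq_top hconn htop,
        hG.hyperbolicityConstant_contract_eq_top hconn he htop]
    -- Of two different longest cycles, at least one avoids `e`.
    · by_cases heC : e ∈ C.edgeSet
      · exact hG.hyperbolicityConstant_contract_eq hconn he hD
          fun heD => hne (hG e he C D hC.1 hD.1 heC heD)
      · exact hG.hyperbolicityConstant_contract_eq hconn he hC heC
  · exact (hG.hyperbolicityConstant_contract_lt hconn he hC heC).ne heq
  · exact hG.hyperbolicityConstant_contract_eq hconn he (hC ▸ rfl) heC
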